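/- Let $\mathcal H$ be a complex Hilbert space with an orthonormal basis $(|n\rangle)_{n\ge 0}$ (the number states), let $a=\sum_{n\ge0}\sqrt{n+1}\,|n\rangle\langle n+1|$ and $a^*=\sum_{n\ge0}\sqrt{n+1}\,|n+1\rangle\langle n|$ be the ladder operators, let $D_z=e^{za^*-\overline z a}$ for $z\in\mathbb C$, and let $\lambda$ be the Lebesgue measure on $\mathbb C$. For $s\in\mathbb N_0$ let $A^{|s\rangle}$ be the phase space observable given on Borel sets $Z\subseteq\mathbb C$ by the weak integral $$A^{|s\rangle}(Z)=\frac1\pi\int_Z D_z|s\rangle\langle s|D_z^*\,d\lambda(z).$$ For a normalized positive operator measure $E$ on the Borel sets of $\mathbb C$ and $\psi,\varphi\in\mathcal H$ let $E_{\psi,\varphi}$ be the complex measure $Z\mapsto\langle\psi,E(Z)\varphi\rangle$. The moment operator $E[m,n]=\int z^m\overline z^n\,dE(z)$, $m,n\in\mathbb N_0$, is the linear operator whose domain consists of all $\varphi\in\mathcal H$ such that $z^m\overline z^n$ is integrable with respect to $E_{\psi,\varphi}$ for every $\psi\in\mathcal H$, and which is determined by $\langle\psi,E[m,n]\varphi\rangle=\int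 z^m\overline z^n\,dE_{\psi,\varphi}(z)$ for all $\psi\in\mathcal H$. Then for every $s\in\mathbb N_0$ the following hold. 1. The weak integrals above define a unique normalized positive operator measure $A^{|s\rangle}$, and the linear span of the number states is contained in the domain of every moment operator $A^{|s\rangle}[m,n]$. 2. $A^{|s\rangle}$ is determinate: if $E$ is a normalized positive operator measure on $\mathbb C$ with $E[m,n]=A^{|s\rangle}[m,n]$ (as operators, with equal domains) for all $m,n\in\mathbb N_0$, then $E=A^{|s\rangle}$. 3. More strongly, if $E$ is a normalized positive operator measure on $\mathbb C$ such that, for all $m,n\in\mathbb N_0$, the span of the number states is contained in the domain of $E[m,n]$ and $E[m,n]=A^{|s\rangle}[m,n]$ on this span, then $E=A^{|s\rangle}$. -/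

import Mathlib

open MeasureTheory Complex ComplexConjugate InnerProductSpace

noncomputable section

namespace PhaseSpace

/-- The lowering operator `a = ∑ √(n+1) |n⟩⟨n+1|` on finite linear combinations of number states,
given by their coefficients. -/
def lowering : (ℕ →₀ ℂ) →ₗ[ℂ] (ℕ →₀ ℂ) :=
  Finsupp.linearCombination ℂ fun n => Finsupp.single (n - 1) ((√(n : ℝ) : ℝ) : ℂ)

/-- The raising operator `a* = ∑ √(n+1) |n+1⟩⟨n|` on finite linear combinations of number states,
given by their coefficients. -/
def raising : (ℕ →₀ ℂ) →ₗ[ℂ] (ℕ →₀ ℂ) :=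
  Finsupp.linearCombination ℂ fun n => Finsupp.single (n + 1) ((√((n : ℝ) + 1) : ℝ) : ℂ)

/-- The operator `z a* - z̄ a` on finite linear combinations of number states. -/
def generator (z : ℂ) : (ℕ →₀ ℂ) →ₗ[ℂ] (ℕ →₀ ℂ) :=
  z • raising - conj z • lowering

section Displacement

variable {H : Type*} [NormedAddCommGroup H] [InnerProductSpace ℂ H]

/-- The vector of `H` with the given finitely many coefficients in the number basis. -/
def toVector (b : HilbertBasis ℕ ℂ H) : (ℕ →₀ ℂ) →ₗ[ℂ] H :=
  Finsupp.linearCombination ℂ b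

/-- The `j`-th term `(z a* - z̄ a)^j |k⟩ / j!` of the exponential series. -/
def expTerm (b : HilbertBasis ℕ ℂ H) (z : ℂ) (k j : ℕ) : H :=
  ((j.factorial : ℂ)⁻¹) • toVector b ((generator z ^ j) (Finsupp.single k 1))

lemma inner_toVector (b : HilbertBasis ℕ ℂ H) (m n : ℕ) (x y : ℂ) :
    inner ℂ (toVector b (Finsupp.single m x)) (toVector b (Finsupp.single n y))
      = if m = n then conj x * y else 0 := by
  simp only [toVector, Finsupp.linearCombination_single, inner_smul_left, inner_smul_right]
  rw [orthonormal_iff_ite.1 b.orthonormal]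
  split_ifs <;> simp [mul_comm]

lemma inner_generator (b : HilbertBasis ℕ ℂ H) (z : ℂ) (u v : ℕ →₀ ℂ) :
    inner ℂ (toVector b (generator z u)) (toVector b v)
      = - inner ℂ (toVector b u) (toVector b (generator z v)) := by
  induction u using Finsupp.induction_linear with
  | zero => simp
  | add f g hf hg => simp only [map_add, inner_add_left, hf, hg]; ring
  | single m x =>
    induction v using Finsupp.induction_linear with
    | zero => simp
    | add f g hf hg => simp only [map_add, inner_add_right, hf, hg]; ring
    | single n y =>
      simp only [generator, raising, lowering, LinearMap.sub_apply, LinearMap.smul_apply,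
        Finsupp.linearCombination_single, map_sub, map_smul, inner_sub_left, inner_sub_right,
        inner_smul_left, inner_smul_right, inner_toVector]
      rcases eq_or_ne (m + 1) n with h | h
      · subst h
        have h1 : m - 1 ≠ m + 1 := by omega
        have h2 : m ≠ m + 1 + 1 := by omega
        simp [h1, h2]; left; ring
      · rcases eq_or_ne m (n + 1) with h' | h'
        · subst h'
          have h1 : n + 1 ≠ n - 1 := by omega
          have h2 : n + 1 + 1 ≠ n := by omega
          simp [h1, h2]; left; ring
        · by_cases h1 : m - 1 = n
          · have : m = 0 := by omega
            subst this
            by_cases h2 : 0 = n - 1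
            · have : n = 0 := by omega
              subst this; simp
            · simp [h, h2]
          · by_cases h2 : m = n - 1
            · have : n = 0 := by omega
              subst this; simp [h', h1]
            · simp [h, h', h1, h2]

lemma inner_generator_pow (b : HilbertBasis ℕ ℂ H) (z : ℂ) (i : ℕ) (u v : ℕ →₀ ℂ) :
    inner ℂ (toVector b ((generator z ^ i) u)) (toVector b v)
      = (-1) ^ i * inner ℂ (toVector b u) (toVector b ((generator z ^ i) v)) := by
  induction i generalizing u v with
  | zero => simp
  | succ i ih =>
    rw [pow_succ', Module.End.mul_apply, inner_generator, ih, ← Module.End.mul_apply, ← pow_succ,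
      pow_succ (-1 : ℂ), pow_succ']
    ring

lemma norm_generator_pow_le (b : HilbertBasis ℕ ℂ H) (z : ℂ) (j k : ℕ) :
    ‖toVector b ((generator z ^ j) (Finsupp.single k 1))‖
      ≤ (2 * ‖z‖) ^ j * √((k + 1).ascFactorial j : ℝ) := by
  induction j generalizing k with
  | zero => simp [toVector, b.orthonormal.1 k]
  | succ j ih =>
    have key : (generator z ^ (j + 1)) (Finsupp.single k 1)
        = (z * ((√((k : ℝ) + 1) : ℝ) : ℂ)) • (generator z ^ j) (Finsupp.single (k + 1) 1)
          - (conj z * ((√(k : ℝ) : ℝ) : ℂ)) • (generator z ^ j) (Finsupp.single (k - 1) 1) := by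
      rw [pow_succ, Module.End.mul_apply, ← map_smul, ← map_smul, ← map_sub]
      congr 1
      simp [generator, raising, lowering]
    rw [key, map_sub, map_smul, map_smul]
    refine (norm_sub_le _ _).trans ?_
    rw [norm_smul, norm_smul, norm_mul, norm_mul, RCLike.norm_conj, norm_real, norm_real,
      Real.norm_of_nonneg (Real.sqrt_nonneg _), Real.norm_of_nonneg (Real.sqrt_nonneg _)]
    have e : √((k + 1).ascFactorial (j + 1) : ℝ)
        = √((k : ℝ) + 1) * √((k + 1 + 1).ascFactorial j : ℝ) := by
      rw [← Real.sqrt_mul (by positivity)]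
      congr 1
      have := Nat.succ_ascFactorial (k + 1) j
      rw [Nat.ascFactorial_succ, ← this]
      push_cast; ring
    have h1 := ih (k + 1)
    have h2 : ‖toVector b ((generator z ^ j) (Finsupp.single (k - 1) 1))‖
        ≤ (2 * ‖z‖) ^ j * √((k + 1 + 1).ascFactorial j : ℝ) := by
      refine (ih (k - 1)).trans ?_
      gcongr
      omega
    have h3 : √(k : ℝ) ≤ √((k : ℝ) + 1) := Real.sqrt_le_sqrt (by linarith)
    calc _ ≤ ‖z‖ * √((k : ℝ) + 1) * ((2 * ‖z‖) ^ j * √((k + 1 + 1).ascFactorial j : ℝ))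
        + ‖z‖ * √((k : ℝ) + 1) * ((2 * ‖z‖) ^ j * √((k + 1 + 1).ascFactorial j : ℝ)) := by
          gcongr
      _ = _ := by rw [e]; ring

lemma summable_norm_expTerm (b : HilbertBasis ℕ ℂ H) (z : ℂ) (k : ℕ) :
    Summable fun j => ‖expTerm b z k j‖ := by
  set x : ℝ := 2 * ‖z‖ with hx
  have hx0 : 0 ≤ x := by positivity
  have hg : Summable fun j : ℕ => √((2 : ℝ) ^ k * Real.exp (8 * x ^ 2)) * (1 / 2 : ℝ) ^ j :=
    (summable_geometric_of_lt_one (by norm_num) (by norm_num)).mul_left _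
  refine Summable.of_nonneg_of_le (fun _ => norm_nonneg _) (fun j => ?_) hg
  rw [expTerm, norm_smul, norm_inv, Complex.norm_natCast]
  refine (mul_le_mul_of_nonneg_left (norm_generator_pow_le b z j k) (by positivity)).trans ?_
  rw [← hx]
  clear_value x
  refine le_of_sq_le_sq ?_ (by positivity)
  have hf : (0 : ℝ) < j.factorial := by exact_mod_cast j.factorial_pos
  have h1 : ((k + 1).ascFactorial j : ℝ) ≤ 2 ^ (k + j) * j.factorial := by
    have : (k + 1).ascFactorial j = j.factorial * (k + j).choose j :=
      Nat.ascFactorial_eq_factorial_mul_choose k j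
    rw [this]
    have h := Nat.choose_le_two_pow (k + j) j
    push_cast
    rw [mul_comm]
    gcongr
    exact_mod_cast h
  have h2 := Real.pow_div_factorial_le_exp (8 * x ^ 2) (by positivity) j
  rw [mul_pow, mul_pow, mul_pow, Real.sq_sqrt (by positivity), Real.sq_sqrt (by positivity)]
  calc ((j.factorial : ℝ)⁻¹) ^ 2 * ((x ^ j) ^ 2 * ((k + 1).ascFactorial j : ℝ))
      ≤ ((j.factorial : ℝ)⁻¹) ^ 2 * ((x ^ j) ^ 2 * (2 ^ (k + j) * j.factorial)) := by gcongr
    _ = 2 ^ k * ((8 * x ^ 2) ^ j / j.factorial) * ((1 / 2) ^ j) ^ 2 := by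
      have : (8 : ℝ) ^ j = 2 ^ j * (2 ^ j) ^ 2 := by
        rw [← pow_mul, ← pow_add, show (8 : ℝ) = 2 ^ 3 by norm_num, ← pow_mul]; congr 1; ring
      rw [mul_pow, this, ← pow_mul x 2 j, mul_comm 2 j, pow_mul x j 2,
        one_div_pow, pow_add]
      field_simp
    _ ≤ _ := by gcongr

lemma summable_expTerm [CompleteSpace H] (b : HilbertBasis ℕ ℂ H) (z : ℂ) (k : ℕ) :
    Summable (expTerm b z k) :=
  (summable_norm_expTerm b z k).of_norm

/-- The vector `D_z |k⟩ = ∑_j (z a* - z̄ a)^j |k⟩ / j!`. -/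
def displacedNumberState (b : HilbertBasis ℕ ℂ H) (z : ℂ) (k : ℕ) : H :=
  ∑' j, expTerm b z k j

lemma inner_expTerm (b : HilbertBasis ℕ ℂ H) (z : ℂ) (k l i j : ℕ) :
    inner ℂ (expTerm b z k i) (expTerm b z l j)
      = ((i.factorial : ℂ)⁻¹ * (j.factorial : ℂ)⁻¹ * (-1) ^ i) *
        inner ℂ (toVector b (Finsupp.single k 1))
          (toVector b ((generator z ^ (i + j)) (Finsupp.single l 1))) := by
  rw [expTerm, expTerm, inner_smul_left, inner_smul_right, inner_generator_pow,
    ← Module.End.mul_apply, ← pow_add, map_inv₀, map_natCast]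
  ring

lemma sum_antidiagonal_coeff (n : ℕ) :
    ∑ p ∈ Finset.HasAntidiagonal.antidiagonal n, ((p.1.factorial : ℂ)⁻¹ * (p.2.factorial : ℂ)⁻¹ * (-1) ^ p.1)
      = if n = 0 then 1 else 0 := by
  rcases Nat.eq_zero_or_pos n with rfl | hn
  · simp
  · have h := (Commute.all (-1 : ℂ) 1).add_pow' n
    rw [neg_add_cancel, zero_pow hn.ne'] at h
    rw [if_neg hn.ne']
    have hf : (n.factorial : ℂ) ≠ 0 := by exact_mod_cast n.factorial_ne_zero
    apply (mul_eq_zero.1 _).resolve_left hf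
    rw [h, Finset.mul_sum]
    refine Finset.sum_congr rfl fun p hp => ?_
    rw [Finset.HasAntidiagonal.mem_antidiagonal] at hp
    have hc := Nat.choose_mul_factorial_mul_factorial (n := n) (k := p.1) (by omega)
    rw [show n - p.1 = p.2 by omega] at hc
    have h1 : (p.1.factorial : ℂ) ≠ 0 := by exact_mod_cast p.1.factorial_ne_zero
    have h2 : (p.2.factorial : ℂ) ≠ 0 := by exact_mod_cast p.2.factorial_ne_zero
    rw [← hc]
    push_cast
    simp only [one_pow, mul_one, nsmul_eq_mul]
    field_simp

lemma orthonormal_displacedNumberState [CompleteSpace H] (b : HilbertBasis ℕ ℂ H) (z : ℂ) :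
    Orthonormal ℂ (displacedNumberState b z) := by
  rw [orthonormal_iff_ite]
  intro k l
  have hk := summable_expTerm b z k
  have hl := summable_expTerm b z l
  have hs : Summable fun p : ℕ × ℕ => inner ℂ (expTerm b z k p.1) (expTerm b z l p.2) := by
    refine Summable.of_norm_bounded ((summable_norm_expTerm b z k).mul_of_nonneg
      (summable_norm_expTerm b z l) (fun _ => norm_nonneg _) (fun _ => norm_nonneg _)) fun p => ?_
    exact norm_inner_le_norm _ _
  have h1 : inner ℂ (displacedNumberState b z k) (displacedNumberState b z l)
      = ∑' p : ℕ × ℕ, inner ℂ (expTerm b z k p.1) (expTerm b z l p.2) := by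
    rw [hs.tsum_prod]
    have e1 : ∀ v : H, inner ℂ (displacedNumberState b z k) v
        = ∑' i, inner ℂ (expTerm b z k i) v := fun v => by
      have h := (innerSL ℂ v).hasSum hk.hasSum
      have h' := (Complex.hasSum_conj'.2 h).tsum_eq
      simpa [displacedNumberState] using h'.symm
    rw [e1]
    refine tsum_congr fun i => ?_
    exact ((innerSL ℂ (expTerm b z k i)).hasSum hl.hasSum).tsum_eq.symm
  have hσ := (Finset.HasAntidiagonal.sigmaAntidiagonalEquivProd.summable_iff.2 hs).tsum_sigma'
      fun n => (hasSum_fintype _).summable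
  rw [h1, ← Finset.HasAntidiagonal.sigmaAntidiagonalEquivProd.tsum_eq]
  refine Eq.trans hσ ?_
  have h2 : ∀ n : ℕ, (∑' c : Finset.HasAntidiagonal.antidiagonal n,
      inner ℂ (expTerm b z k c.1.1) (expTerm b z l c.1.2))
      = (if n = 0 then 1 else 0) * inner ℂ (toVector b (Finsupp.single k 1))
          (toVector b ((generator z ^ n) (Finsupp.single l 1))) := fun n => by
    rw [Finset.tsum_subtype (Finset.HasAntidiagonal.antidiagonal n)
      (fun c : ℕ × ℕ => inner ℂ (expTerm b z k c.1) (expTerm b z l c.2)),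
      ← sum_antidiagonal_coeff, Finset.sum_mul]
    refine Finset.sum_congr rfl fun p hp => ?_
    rw [inner_expTerm, Finset.HasAntidiagonal.mem_antidiagonal.1 hp]
  refine (tsum_congr h2).trans ?_
  rw [tsum_eq_single 0 (fun n hn => by simp [hn])]
  simp [inner_toVector]

/-- The shift operator `D_z = exp(z a* - z̄ a)`: the isometric operator on `H` which acts on every
number state by the (norm convergent) exponential series of `z a* - z̄ a`. -/
def displacement [CompleteSpace H] (b : HilbertBasis ℕ ℂ H) (z : ℂ) : H →L[ℂ] H :=
  ((orthonormal_displacedNumberState b z).orthogonalFamily.linearIsometry.comp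
    b.repr.toLinearIsometry).toContinuousLinearMap

lemma displacement_apply [CompleteSpace H] (b : HilbertBasis ℕ ℂ H) (z : ℂ) (k : ℕ) :
    displacement b z (b k) = displacedNumberState b z k := by
  classical
  simp [displacement, OrthogonalFamily.linearIsometry_apply_single, b.repr_self]

lemma norm_displacement [CompleteSpace H] (b : HilbertBasis ℕ ℂ H) (z : ℂ) (v : H) :
    ‖displacement b z v‖ = ‖v‖ := by
  simp [displacement]

end Displacement

section OperatorMeasure

variable {H : Type*} [NormedAddCommGroup H] [InnerProductSpace ℂ H]

/-- A normalized positive operator measure on the Borel sets of `ℂ`: a (weakly) σ-additive map into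
the positive bounded operators with value the identity on `ℂ`. As for vector measures in Mathlib,
the value on non-Borel sets is `0` by convention. -/
structure PositiveOperatorMeasure (H : Type*) [NormedAddCommGroup H] [InnerProductSpace ℂ H] where
  /-- The operator assigned to a set. -/
  toFun : Set ℂ → H →L[ℂ] H
  not_measurable' : ∀ Z, ¬ MeasurableSet Z → toFun Z = 0
  isPositive' : ∀ Z, MeasurableSet Z → (toFun Z).IsPositive
  map_univ' : toFun Set.univ = 1
  hasSum' : ∀ (Z : ℕ → Set ℂ), (∀ i, MeasurableSet (Z i)) → Pairwise (Function.onFun Disjoint Z) →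
    ∀ ψ φ : H, HasSum (fun i => inner ℂ ψ (toFun (Z i) φ)) (inner ℂ ψ (toFun (⋃ i, Z i) φ))

namespace PositiveOperatorMeasure

instance : CoeFun (PositiveOperatorMeasure H) fun _ => Set ℂ → H →L[ℂ] H := ⟨toFun⟩

@[ext]
lemma ext {E F : PositiveOperatorMeasure H} (h : ∀ Z, MeasurableSet Z → E Z = F Z) : E = F := by
  have : E.toFun = F.toFun := by
    funext Z
    by_cases hZ : MeasurableSet Z
    · exact h Z hZ
    · rw [E.not_measurable' Z hZ, F.not_measurable' Z hZ]
  cases E; cases F; congr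

variable (E : PositiveOperatorMeasure H)

lemma map_empty : E ∅ = 0 := by
  ext φ
  refine ext_inner_left ℂ fun ψ => ?_
  have h := E.hasSum' (fun _ => ∅) (fun _ => MeasurableSet.empty)
    (fun _ _ _ => disjoint_bot_left) ψ φ
  have h0 := h.summable.tendsto_atTop_zero
  simpa using tendsto_nhds_unique tendsto_const_nhds h0

/-- The complex measure `E_{ψ,φ} : Z ↦ ⟨ψ, E(Z) φ⟩`. -/
def complexMeasure (ψ φ : H) : ComplexMeasure ℂ where
  measureOf' Z := inner ℂ ψ (E Z φ)
  empty' := by simp [E.map_empty]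
  not_measurable' Z hZ := by simp [E.not_measurable' Z hZ]
  m_iUnion' Z hZ hd := E.hasSum' Z hZ hd ψ φ

@[simp]
lemma complexMeasure_apply (ψ φ : H) (Z : Set ℂ) :
    E.complexMeasure ψ φ Z = inner ℂ ψ (E Z φ) := rfl

lemma complexMeasure_add_right (ψ φ χ : H) :
    E.complexMeasure ψ (φ + χ) = E.complexMeasure ψ φ + E.complexMeasure ψ χ := by
  ext Z _; simp

lemma complexMeasure_smul_right (c : ℂ) (ψ φ : H) :
    E.complexMeasure ψ (c • φ) = c • E.complexMeasure ψ φ := by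
  ext Z _; simp

lemma complexMeasure_add_left (ψ φ χ : H) :
    E.complexMeasure (ψ + φ) χ = E.complexMeasure ψ χ + E.complexMeasure φ χ := by
  ext Z _; simp

lemma complexMeasure_smul_left (c : ℂ) (ψ φ : H) :
    E.complexMeasure (c • ψ) φ = conj c • E.complexMeasure ψ φ := by
  ext Z _; simp [mul_comm]

lemma isPositive (Z : Set ℂ) : (E Z).IsPositive := by
  by_cases hZ : MeasurableSet Z
  · exact E.isPositive' Z hZ
  · rw [E.not_measurable' Z hZ]; exact ContinuousLinearMap.isPositive_zero

lemma norm_apply_le (Z : Set ℂ) (ψ φ : H) :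
    ‖inner ℂ ψ (E Z φ)‖ ≤ (RCLike.re (inner ℂ ψ (E Z ψ)) + RCLike.re (inner ℂ φ (E Z φ))) / 2 := by
  obtain ⟨c, hc, h⟩ : ∃ c : ℂ, ‖c‖ = 1 ∧ c * inner ℂ ψ (E Z φ) = ‖inner ℂ ψ (E Z φ)‖ := by
    rcases eq_or_ne (inner ℂ ψ (E Z φ)) 0 with h0 | h0
    · exact ⟨1, by simp, by simp [h0]⟩
    · refine ⟨‖inner ℂ ψ (E Z φ)‖ / inner ℂ ψ (E Z φ), ?_, by field_simp⟩
      rw [norm_div, norm_real, norm_norm, div_self (norm_ne_zero_iff.2 h0)]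
  have hp := (E.isPositive Z).re_inner_nonneg_right (ψ - c • φ)
  have hs : inner ℂ φ (E Z ψ) = conj (inner ℂ ψ (E Z φ)) := by
    rw [inner_conj_symm]
    exact ((E.isPositive Z).isSymmetric φ ψ).symm
  have hcc : conj c * c = 1 := by
    rw [mul_comm, mul_conj, normSq_eq_norm_sq, hc]; norm_num
  have e : inner ℂ (ψ - c • φ) (E Z (ψ - c • φ)) = inner ℂ ψ (E Z ψ) + inner ℂ φ (E Z φ)
      - (‖inner ℂ ψ (E Z φ)‖ : ℂ) - conj (‖inner ℂ ψ (E Z φ)‖ : ℂ) := by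
    rw [← h]
    simp only [map_sub, map_smul, inner_sub_left, inner_sub_right, inner_smul_left,
      inner_smul_right, hs, map_mul]
    linear_combination (inner ℂ φ (E Z φ)) * hcc
  rw [e] at hp
  simp at hp ⊢
  linarith

lemma re_apply_le (Z : Set ℂ) (ψ : H) : RCLike.re (inner ℂ ψ (E Z ψ)) ≤ ‖ψ‖ ^ 2 := by
  by_cases hZ : MeasurableSet Z
  · have h := (E.complexMeasure ψ ψ).of_add_of_sdiff hZ MeasurableSet.univ (Set.subset_univ Z)
    simp only [complexMeasure_apply, E.map_univ', one_apply_eq_self] at h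
    have hp := (E.isPositive (Set.univ \ Z)).re_inner_nonneg_right ψ
    have h' := congrArg (RCLike.re (K := ℂ)) h
    rw [map_add, inner_self_eq_norm_sq] at h'
    linarith
  · simp [E.not_measurable' Z hZ]

lemma variation_univ_le (ψ φ : H) :
    (E.complexMeasure ψ φ).variation Set.univ ≤ ENNReal.ofReal ((‖ψ‖ ^ 2 + ‖φ‖ ^ 2) / 2) := by
  by_contra! hlt
  obtain ⟨P, -, hd, hm, hP⟩ :=
    (E.complexMeasure ψ φ).exists_lt_sum_of_lt_variation MeasurableSet.univ hlt
  refine absurd hP (not_lt.2 ?_)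
  have hsum : ∀ χ : H, ∑ p ∈ P, RCLike.re (inner ℂ χ (E p χ)) ≤ ‖χ‖ ^ 2 := fun χ => by
    refine le_trans (le_of_eq ?_) (E.re_apply_le (⋃ p ∈ P, p) χ)
    have := (E.complexMeasure χ χ).of_biUnion_finset hd hm
    simp only [complexMeasure_apply] at this
    simp only [id] at this
    rw [this, map_sum]
  calc ∑ p ∈ P, ‖E.complexMeasure ψ φ p‖ₑ
      ≤ ∑ p ∈ P, ENNReal.ofReal
          ((RCLike.re (inner ℂ ψ (E p ψ)) + RCLike.re (inner ℂ φ (E p φ))) / 2) := by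
        refine Finset.sum_le_sum fun p _ => ?_
        rw [← ofReal_norm]
        exact ENNReal.ofReal_le_ofReal (E.norm_apply_le p ψ φ)
    _ = ENNReal.ofReal (∑ p ∈ P,
          (RCLike.re (inner ℂ ψ (E p ψ)) + RCLike.re (inner ℂ φ (E p φ))) / 2) := by
        rw [ENNReal.ofReal_sum_of_nonneg]
        intro p _
        exact (norm_nonneg _).trans (E.norm_apply_le p ψ φ)
    _ ≤ _ := by
        refine ENNReal.ofReal_le_ofReal ?_
        rw [← Finset.sum_div, Finset.sum_add_distrib]
        linarith [hsum ψ, hsum φ]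

instance (ψ φ : H) : IsFiniteMeasure (E.complexMeasure ψ φ).variation :=
  ⟨(E.variation_univ_le ψ φ).trans_lt ENNReal.ofReal_lt_top⟩

end PositiveOperatorMeasure

/-- The integral of a function with respect to a complex measure. -/
def complexIntegral (μ : ComplexMeasure ℂ) (f : ℂ → ℂ) : ℂ :=
  μ.integral f (ContinuousLinearMap.mul ℝ ℂ)

lemma complexIntegral_smul (c : ℂ) (μ : ComplexMeasure ℂ) (f : ℂ → ℂ) :
    complexIntegral (c • μ) f = c * complexIntegral μ f := by
  rcases eq_or_ne c 0 with rfl | hc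
  · have h0 : (0 : ℂ) • μ = 0 := by ext Z _; simp
    rw [h0, zero_mul]
    exact VectorMeasure.integral_zero_vectorMeasure
  have key : ∀ (m : Measure ℂ) (T T' : Set ℂ → ℂ →L[ℝ] ℂ) (C C' : ℝ)
      (hT : DominatedFinMeasAdditive m T C) (hT' : DominatedFinMeasAdditive m T' C'),
      (∀ s x, T' s x = c * T s x) → setToFun m T' hT' f = c * setToFun m T hT f := by
    intro m T T' C C' hT hT' h
    by_cases hf : Integrable f m
    swap
    · simp [setToFun_undef _ hf]
    refine Integrable.induction (μ := m)
      (fun g => setToFun m T' hT' g = c * setToFun m T hT g) ?_ ?_ ?_ ?_ hf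
    · intro a s hs hms
      simp [setToFun_indicator_const _ hs hms.ne, h]
    · intro g k _ hg hk h1 h2
      rw [setToFun_add _ hg hk, setToFun_add _ hg hk, h1, h2, mul_add]
    · exact isClosed_eq (continuous_setToFun hT') (continuous_const.mul (continuous_setToFun hT))
    · intro g k hgk _ h1
      rw [← setToFun_congr_ae _ hgk, ← setToFun_congr_ae _ hgk, h1]
  have hv : (c • μ).variation = ‖c‖₊ • μ.variation := VectorMeasure.variation_smul
  have hD := dominatedFinMeasAdditive_cbmApplyMeasure (c • μ) (ContinuousLinearMap.mul ℝ ℂ)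
  have hD1 : DominatedFinMeasAdditive (‖c‖₊ • μ.variation)
      ((c • μ).transpose (ContinuousLinearMap.mul ℝ ℂ)) ‖ContinuousLinearMap.mul ℝ ℂ‖ := hv ▸ hD
  have hD2 : DominatedFinMeasAdditive μ.variation
      ((c • μ).transpose (ContinuousLinearMap.mul ℝ ℂ)) (‖ContinuousLinearMap.mul ℝ ℂ‖ * ‖c‖) := by
    refine ⟨fun s t hs ht _ _ hst => VectorMeasure.of_union hst hs ht, fun s hs hsf => ?_⟩
    refine (hD1.2 s hs ?_).trans (le_of_eq ?_)
    · rw [Measure.smul_apply]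
      exact ENNReal.mul_lt_top ENNReal.coe_lt_top hsf
    · rw [measureReal_nnreal_smul_apply, coe_nnnorm, mul_assoc]
  have h1 : complexIntegral (c • μ) f = setToFun (‖c‖₊ • μ.variation)
      ((c • μ).transpose (ContinuousLinearMap.mul ℝ ℂ)) hD1 f := by
    have : ∀ (m m' : Measure ℂ) (T : Set ℂ → ℂ →L[ℝ] ℂ) (C : ℝ)
        (hT : DominatedFinMeasAdditive m T C) (hT' : DominatedFinMeasAdditive m' T C), m = m' →
        setToFun m T hT f = setToFun m' T hT' f := by
      rintro m _ T C hT hT' rfl; rfl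
    exact this _ _ _ _ hD hD1 hv
  rw [h1, ← setToFun_congr_smul_measure' ‖c‖₊ hD2 hD1 f]
  refine key _ _ _ _ _
    (dominatedFinMeasAdditive_cbmApplyMeasure μ (ContinuousLinearMap.mul ℝ ℂ)) hD2 fun s x => ?_
  change x * (c * μ s) = c * (x * μ s)
  ring

lemma complexIntegral_add {μ ν : ComplexMeasure ℂ} {f : ℂ → ℂ} (hμ : μ.Integrable f)
    (hν : ν.Integrable f) :
    complexIntegral (μ + ν) f = complexIntegral μ f + complexIntegral ν f :=
  VectorMeasure.integral_add_vectorMeasure hμ hν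

lemma integrable_smul {μ : ComplexMeasure ℂ} {f : ℂ → ℂ} (c : ℂ) (hμ : μ.Integrable f) :
    (c • μ).Integrable f := by
  have hv : (c • μ).variation = ‖c‖₊ • μ.variation := VectorMeasure.variation_smul
  unfold VectorMeasure.Integrable
  rw [hv]
  exact hμ.smul_measure_nnreal

namespace PositiveOperatorMeasure

variable (E : PositiveOperatorMeasure H)

/-- The subspace of all `φ` such that `f` is integrable with respect to `E_{ψ,φ}` (that is, to its
total variation) for every `ψ`. -/
def integralDomain (f : ℂ → ℂ) : Submodule ℂ H where
  carrier := {φ | ∀ ψ, (E.complexMeasure ψ φ).Integrable f}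
  zero_mem' ψ := by
    have : E.complexMeasure ψ 0 = 0 := by ext Z _; simp
    rw [this]
    exact VectorMeasure.Integrable.zero_vectorMeasure
  add_mem' h1 h2 ψ := by
    rw [complexMeasure_add_right]
    exact (h1 ψ).add_vectorMeasure (h2 ψ)
  smul_mem' c φ h ψ := by
    rw [complexMeasure_smul_right]
    exact integrable_smul c (h ψ)

lemma exists_integral_bounded {f : ℂ → ℂ} {C : ℝ} (hf : Measurable f) (hC : ∀ z, ‖f z‖ ≤ C)
    (φ : H) : ∃ L : H →L[ℂ] ℂ, ∀ ψ, L ψ = conj (complexIntegral (E.complexMeasure ψ φ) f) := by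
  have hi : ∀ ψ, (E.complexMeasure ψ φ).Integrable f := fun ψ =>
    Integrable.of_bound hf.aestronglyMeasurable C (Filter.Eventually.of_forall hC)
  have hC0 : 0 ≤ C := (norm_nonneg _).trans (hC 0)
  let L : H →ₗ[ℂ] ℂ :=
    { toFun := fun ψ => conj (complexIntegral (E.complexMeasure ψ φ) f)
      map_add' := fun ψ χ => by
        rw [complexMeasure_add_left, complexIntegral_add (hi ψ) (hi χ), map_add]
      map_smul' := fun c ψ => by
        rw [complexMeasure_smul_left, complexIntegral_smul, map_mul, conj_conj]
        rfl }
  refine ⟨L.mkContinuousOfExistsBound ⟨_, L.bound_of_ball_bound' one_pos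
    (C * ‖ContinuousLinearMap.mul ℝ ℂ‖ * ((1 ^ 2 + ‖φ‖ ^ 2) / 2)) fun ψ hψ => ?_⟩, fun ψ => rfl⟩
  rw [mem_closedBall_zero_iff] at hψ
  change ‖conj (complexIntegral (E.complexMeasure ψ φ) f)‖ ≤ _
  rw [RCLike.norm_conj]
  refine (VectorMeasure.norm_integral_le_of_norm_le_const (Filter.Eventually.of_forall hC)).trans ?_
  gcongr
  refine (ENNReal.toReal_le_of_le_ofReal (by positivity) (E.variation_univ_le ψ φ)).trans ?_
  gcongr

variable [CompleteSpace H]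

lemma exists_integral {f : ℂ → ℂ} (hf : Measurable f) (φ : E.integralDomain f) :
    ∃ χ : H, ∀ ψ, inner ℂ ψ χ = complexIntegral (E.complexMeasure ψ φ) f := by
  let g : ℕ → ℂ → ℂ := fun n => {z | ‖f z‖ ≤ n}.indicator f
  have hg : ∀ n, Measurable (g n) := fun n => hf.indicator (measurableSet_le hf.norm measurable_const)
  have hgn : ∀ n z, ‖g n z‖ ≤ n := fun n z => by
    by_cases h : ‖f z‖ ≤ n
    · rwa [show g n z = f z from Set.indicator_of_mem (s := {z | ‖f z‖ ≤ n}) h f]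
    · rw [show g n z = 0 from Set.indicator_of_notMem (s := {z | ‖f z‖ ≤ n}) h f]
      simp
  choose L hL using fun n => E.exists_integral_bounded (hg n) (hgn n) (φ : H)
  have hlim : Filter.Tendsto (fun n ψ => L n ψ) Filter.atTop
      (nhds fun ψ => conj (complexIntegral (E.complexMeasure ψ φ) f)) := by
    refine tendsto_pi_nhds.2 fun ψ => ?_
    simp only [hL]
    refine (continuous_conj.tendsto _).comp
      (VectorMeasure.tendsto_integral_of_dominated_convergence (fun z => ‖f z‖)
        (fun n => (hg n).aestronglyMeasurable) (φ.2 ψ).norm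
        (fun n => Filter.Eventually.of_forall fun z => norm_indicator_le_norm_self _ _)
        (Filter.Eventually.of_forall fun z => ?_))
    obtain ⟨N, hN⟩ := exists_nat_ge ‖f z‖
    refine tendsto_const_nhds.congr' ?_
    filter_upwards [Filter.eventually_ge_atTop N] with n hn
    exact (Set.indicator_of_mem (s := {z | ‖f z‖ ≤ n}) (hN.trans (by exact_mod_cast hn)) f).symm
  let M : H →L[ℂ] ℂ := continuousLinearMapOfTendsto L hlim
  refine ⟨(toDual ℂ H).symm M, fun ψ => ?_⟩
  rw [← inner_conj_symm, toDual_symm_apply]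
  change conj (conj (complexIntegral (E.complexMeasure ψ φ) f)) = _
  rw [conj_conj]

/-- The operator `∫ f dE`, on the domain of all `φ` such that `f` is integrable with respect to
`E_{ψ,φ}` for every `ψ`, determined by `⟨ψ, (∫ f dE) φ⟩ = ∫ f dE_{ψ,φ}` for every `ψ`. -/
def operatorIntegral (f : ℂ → ℂ) (hf : Measurable f) : H →ₗ.[ℂ] H where
  domain := E.integralDomain f
  toFun :=
    { toFun := fun φ => (E.exists_integral hf φ).choose
      map_add' := fun φ χ => by
        refine ext_inner_left ℂ fun ψ => ?_
        rw [inner_add_right, (E.exists_integral hf _).choose_spec,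
          (E.exists_integral hf _).choose_spec, (E.exists_integral hf _).choose_spec,
          Submodule.coe_add, complexMeasure_add_right, complexIntegral_add (φ.2 ψ) (χ.2 ψ)]
      map_smul' := fun c φ => by
        refine ext_inner_left ℂ fun ψ => ?_
        rw [RingHom.id_apply, inner_smul_right, (E.exists_integral hf _).choose_spec,
          (E.exists_integral hf _).choose_spec,
          Submodule.coe_smul, complexMeasure_smul_right, complexIntegral_smul] }

lemma inner_operatorIntegral (f : ℂ → ℂ) (hf : Measurable f)
    (φ : (E.operatorIntegral f hf).domain) (ψ : H) :
    inner ℂ ψ (E.operatorIntegral f hf φ) = complexIntegral (E.complexMeasure ψ φ) f :=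
  (E.exists_integral hf φ).choose_spec ψ

/-- The moment operator `E[m,n] = ∫ z^m z̄^n dE(z)`. -/
def moment (m n : ℕ) : H →ₗ.[ℂ] H :=
  E.operatorIntegral (fun z => z ^ m * conj z ^ n) (by fun_prop)

/-- `E` is determinate: it is the only normalized positive operator measure with its moment
operators (equality of the moment operators includes equality of their domains). -/
def IsDeterminate : Prop :=
  ∀ F : PositiveOperatorMeasure H, (∀ m n : ℕ, F.moment m n = E.moment m n) → F = E

end PositiveOperatorMeasure

/-- `A` is the phase space observable `A^T` generated by the operator `T`, with respect to the number
basis `b`: for every Borel set `Z`, `A(Z) = π⁻¹ ∫_Z D_z T D_z* dλ(z)` as a weak integral, with `λ`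
the Lebesgue measure on `ℂ`. -/
def IsPhaseSpaceObservable [CompleteSpace H] (b : HilbertBasis ℕ ℂ H) (T : H →L[ℂ] H)
    (A : PositiveOperatorMeasure H) : Prop :=
  ∀ ψ φ : H,
    Integrable (fun z : ℂ =>
      inner ℂ ψ (displacement b z (T (ContinuousLinearMap.adjoint (displacement b z) φ)))) ∧
    ∀ Z : Set ℂ, MeasurableSet Z →
      inner ℂ ψ (A Z φ) = (Real.pi : ℂ)⁻¹ * ∫ z in Z,
        inner ℂ ψ (displacement b z (T (ContinuousLinearMap.adjoint (displacement b z) φ)))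

/-- The number state `|s⟩⟨s|` as an operator. -/
def numberState (b : HilbertBasis ℕ ℂ H) (s : ℕ) : H →L[ℂ] H :=
  rankOne ℂ (b s) (b s)

/-- The linear span of the number states. -/
def numberSpan (b : HilbertBasis ℕ ℂ H) : Submodule ℂ H :=
  Submodule.span ℂ (Set.range b)

end OperatorMeasure

end PhaseSpace

end

/-!
Write `c_{n,k}(z) = ⟨n, D_z k⟩` for the matrix elements of the shift operators. They are Gaussians
times polynomials: `c_{n,k}(z) = exp(-|z|²/2) p_{n,k}(z, z̄)` (`inner_displacedNumberState`), where
`p_{n,0} = zⁿ/√n!` and `√(k+1) p_{n,k+1} = (∂_z - z̄) p_{n,k}` (`displacementPoly`). To see this,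
replace `z` by `t z`: both sides are entire in `t`, and the right side obeys the differential
equations that force its Taylor coefficients at `0` to be those of the exponential series.

Integration by parts against the Gaussian makes `∂_z - z̄` and `-∂_z̄` adjoint to each other
(`gaussianForm_pderiv_sub`). Induction on `s` then shows that the functions
`z ↦ ⟨D_z s, n⟩ = conj c_{n,s}(z)`, `n ∈ ℕ`, are orthogonal in `L²(ℂ)` with squared norm `π`
(`gaussianForm_displacementPoly`). Hence `φ ↦ (z ↦ ⟨D_z s, φ⟩) / √π` is an isometry `W` from `H`
into `L²(ℂ)` (`amplitudeIsometry`), and compressing the multiplication by the indicator function of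
`Z` by `W` gives the observable `A(Z) = π⁻¹ ∫_Z D_z |s⟩⟨s| D_z^* dλ(z)` (`numberStateObservable`).

For `φ` in the span of the number states, `A_{φ,φ}` has the density `π⁻¹ |⟨D_z s, φ⟩|²`, which is
`exp(-|z|²)` times a polynomial in `z` and `z̄`. All moments therefore exist
(`numberSpan_le_domain_moment`), and even `exp(c |z|)` is integrable for every `c`. A finite measure
on `ℂ` with this property is determined by its moments (`eq_of_moments_eq`): the even absolute
moments of a competitor control its integral of `cosh(c |z|)`, so that the power series of both
characteristic functions can be integrated term by term. If `E` has the moment operators of `A` on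
the span, it follows that `E_{φ,φ} = A_{φ,φ}` for every `φ` in this dense subspace, and polarization
gives `E = A` (`eq_of_moment_domRestrict_eq`).
-/

namespace PhaseSpace

open MvPolynomial

/-! ### The polynomials of the matrix elements -/

/-- The polynomial `p_{n,k}` in `z` (variable `0`) and `z̄` (variable `1`) for which
`⟨n, D_z k⟩ = exp(-|z|²/2) p_{n,k}(z, z̄)`. -/
noncomputable def displacementPoly (n : ℕ) : ℕ → MvPolynomial (Fin 2) ℂ
  | 0 => C ((√(n.factorial : ℝ) : ℝ) : ℂ)⁻¹ * X 0 ^ n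
  | k + 1 => C ((√((k : ℝ) + 1) : ℝ) : ℂ)⁻¹ *
      (pderiv 0 (displacementPoly n k) - X 1 * displacementPoly n k)

lemma ofReal_sqrt_ne_zero {x : ℝ} (hx : 0 < x) : ((√x : ℝ) : ℂ) ≠ 0 :=
  ofReal_ne_zero.2 (Real.sqrt_pos.2 hx).ne'

lemma ofReal_sqrt_mul_self {x : ℝ} (hx : 0 ≤ x) : ((√x : ℝ) : ℂ) * ((√x : ℝ) : ℂ) = x := by
  rw [← ofReal_mul, Real.mul_self_sqrt hx]

lemma sqrt_smul_displacementPoly_succ (n k : ℕ) :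
    ((√((k : ℝ) + 1) : ℝ) : ℂ) • displacementPoly n (k + 1)
      = pderiv 0 (displacementPoly n k) - X 1 * displacementPoly n k := by
  rw [displacementPoly, ← smul_eq_C_mul, smul_smul,
    mul_inv_cancel₀ (ofReal_sqrt_ne_zero (by positivity)), one_smul]

lemma pderiv_comm_apply (i j : Fin 2) (p : MvPolynomial (Fin 2) ℂ) :
    pderiv i (pderiv j p) = pderiv j (pderiv i p) := by
  have h : ⁅(pderiv i : Derivation ℂ (MvPolynomial (Fin 2) ℂ) (MvPolynomial (Fin 2) ℂ)),
      (pderiv j : Derivation ℂ (MvPolynomial (Fin 2) ℂ) (MvPolynomial (Fin 2) ℂ))⁆ = 0 := by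
    refine MvPolynomial.derivation_ext fun k => ?_
    rw [Derivation.commutator_apply, pderiv_X, pderiv_X]
    simp [Pi.single_apply, apply_ite]
  have := congrArg (fun D => D p) h
  simpa [Derivation.commutator_apply, sub_eq_zero] using this

/-- `∂_z p_{n,k} = √n p_{n-1,k}`. For `n = 0` the coefficient vanishes, so the truncated `n - 1` is
harmless. -/
lemma pderiv_zero_displacementPoly (n k : ℕ) :
    pderiv 0 (displacementPoly n k) = ((√(n : ℝ) : ℝ) : ℂ) • displacementPoly (n - 1) k := by
  induction k with
  | zero =>
    rcases n with _ | n
    · simp [displacementPoly]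
    · simp only [displacementPoly, ← smul_eq_C_mul, Derivation.map_smul, pderiv_pow, pderiv_X_self,
        mul_one, smul_smul]
      rw [show ((n + 1 : ℕ) : MvPolynomial (Fin 2) ℂ) = C ((n + 1 : ℕ) : ℂ) by simp,
        ← smul_eq_C_mul, smul_smul]
      congr 1
      have h : √((n + 1).factorial : ℝ) = √((n : ℝ) + 1) * √(n.factorial : ℝ) := by
        rw [Nat.factorial_succ, ← Real.sqrt_mul (by positivity)]; push_cast; rfl
      have h1 := ofReal_sqrt_ne_zero (x := n.factorial) (by positivity)
      have h2 := ofReal_sqrt_ne_zero (x := (n : ℝ) + 1) (by positivity)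
      have h3 := ofReal_sqrt_mul_self (x := (n : ℝ) + 1) (by positivity)
      push_cast at h3 ⊢
      rw [h, ofReal_mul]
      field_simp
      rw [← h3, sq]
  | succ k ih =>
    have h : pderiv 0 (pderiv 0 (displacementPoly n k) - X 1 * displacementPoly n k)
        = ((√(n : ℝ) : ℝ) : ℂ) •
          (pderiv 0 (displacementPoly (n - 1) k) - X 1 * displacementPoly (n - 1) k) := by
      rw [ih, map_sub, Derivation.leibniz, ih, pderiv_X_of_ne (by decide), Derivation.map_smul]
      simp only [smul_sub, mul_zero, add_zero, smul_eq_mul, mul_smul_comm]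
    simp only [displacementPoly, ← smul_eq_C_mul, Derivation.map_smul, h]
    rw [smul_comm]

/-- `∂_z̄ p_{n,k} = -√k p_{n,k-1}`; for `k = 0` the coefficient vanishes. -/
lemma pderiv_one_displacementPoly (n k : ℕ) :
    pderiv 1 (displacementPoly n k) = -(((√(k : ℝ) : ℝ) : ℂ) • displacementPoly n (k - 1)) := by
  induction k with
  | zero => simp [displacementPoly, ← smul_eq_C_mul, Derivation.map_smul]
  | succ k ih =>
    have h : pderiv 1 (pderiv 0 (displacementPoly n k) - X 1 * displacementPoly n k)
        = -(((k : ℂ) + 1) • displacementPoly n k) := by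
      rw [map_sub, pderiv_comm_apply, Derivation.leibniz, pderiv_X_self, ih, map_neg,
        Derivation.map_smul]
      rcases k with _ | k
      · simp
      · have h3 := ofReal_sqrt_mul_self (x := (k : ℝ) + 1) (by positivity)
        have h4 := sqrt_smul_displacementPoly_succ n k
        rw [eq_comm, sub_eq_iff_eq_add] at h4
        push_cast at h3 ⊢
        rw [h4, smul_add, smul_smul, h3]
        simp only [smul_eq_mul, mul_one, mul_neg, mul_smul_comm]
        module
    have h3 := ofReal_sqrt_mul_self (x := (k : ℝ) + 1) (by positivity)
    have h2 := ofReal_sqrt_ne_zero (x := (k : ℝ) + 1) (by positivity)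
    rw [displacementPoly, ← smul_eq_C_mul, Derivation.map_smul, h, smul_neg, smul_smul,
      Nat.add_sub_cancel]
    congr 2
    rw [Nat.cast_succ] at *
    push_cast at h3 ⊢
    rw [← h3]
    field_simp

lemma eval_zero_displacementPoly (n k : ℕ) :
    eval 0 (displacementPoly n k) = if n = k then 1 else 0 := by
  induction k generalizing n with
  | zero =>
    rcases n with _ | n <;> simp [displacementPoly]
  | succ k ih =>
    rw [displacementPoly, pderiv_zero_displacementPoly]
    simp only [map_mul, eval_C, map_sub, smul_eval, ih, eval_X, Pi.zero_apply, zero_mul, sub_zero]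
    rcases n with _ | n
    · simp
    · have h2 := ofReal_sqrt_ne_zero (x := (k : ℝ) + 1) (by positivity)
      by_cases h : n = k
      · subst h; simp [h2]
      · simp [h]

section MatrixElements

/-! ### Matrix elements of the shift operators -/

/-- The chain rule for a polynomial in two variables along the line through `0` and `(x, y)`. -/
lemma hasDerivAt_eval_ray (p : MvPolynomial (Fin 2) ℂ) (x y t : ℂ) :
    HasDerivAt (fun t : ℂ => eval ![t * x, t * y] p)
      (x * eval ![t * x, t * y] (pderiv 0 p) + y * eval ![t * x, t * y] (pderiv 1 p)) t := by
  induction p using MvPolynomial.induction_on with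
  | C a => simpa using hasDerivAt_const t a
  | add p q hp hq =>
    simp only [map_add]
    exact (hp.add hq).congr_deriv (by ring)
  | mul_X p i hp =>
    have hX : HasDerivAt (fun t : ℂ => (![t * x, t * y] : Fin 2 → ℂ) i) (![x, y] i) t := by
      fin_cases i <;> simpa using hasDerivAt_mul_const _
    simp only [map_mul, eval_X]
    refine (hp.mul hX).congr_deriv ?_
    fin_cases i <;> simp [pderiv_X] <;> ring

/-- The matrix element `⟨n, D_{tz} k⟩` as an entire function of `t`, in its closed form. -/
noncomputable def displacementCoeff (n k : ℕ) (z : ℂ) (t : ℂ) : ℂ :=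
  cexp (-(t ^ 2 * (z * conj z) / 2)) * eval ![t * z, t * conj z] (displacementPoly n k)

/-- The equation `d/dt ⟨n, D_{tz} k⟩ = ⟨n, D_{tz} (z a* - z̄ a) k⟩` for the closed form. -/
lemma hasDerivAt_displacementCoeff (n k : ℕ) (z t : ℂ) :
    HasDerivAt (displacementCoeff n k z)
      (z * ((√((k : ℝ) + 1) : ℝ) : ℂ) * displacementCoeff n (k + 1) z t
        - conj z * ((√(k : ℝ) : ℝ) : ℂ) * displacementCoeff n (k - 1) z t) t := by
  have h1 : HasDerivAt (fun t : ℂ => cexp (-(t ^ 2 * (z * conj z) / 2)))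
      (cexp (-(t ^ 2 * (z * conj z) / 2)) * (-(t * (z * conj z)))) t := by
    refine HasDerivAt.cexp ?_
    exact ((((hasDerivAt_id t).pow 2).mul_const (z * conj z)).div_const 2).neg.congr_deriv
      (by simp; ring)
  refine (h1.mul (hasDerivAt_eval_ray (displacementPoly n k) z (conj z) t)).congr_deriv ?_
  have h2 : pderiv 0 (displacementPoly n k)
      = ((√((k : ℝ) + 1) : ℝ) : ℂ) • displacementPoly n (k + 1) + X 1 * displacementPoly n k := by
    rw [sqrt_smul_displacementPoly_succ]; ring
  rw [h2, pderiv_one_displacementPoly]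
  simp only [displacementCoeff, map_add, map_neg, map_mul, smul_eval, eval_X, Matrix.cons_val_one,
    Matrix.cons_val_fin_one]
  ring

lemma differentiable_displacementCoeff (n k : ℕ) (z : ℂ) :
    Differentiable ℂ (displacementCoeff n k z) :=
  fun t => (hasDerivAt_displacementCoeff n k z t).differentiableAt

lemma deriv_displacementCoeff (n k : ℕ) (z : ℂ) :
    deriv (displacementCoeff n k z)
      = (fun t => z * ((√((k : ℝ) + 1) : ℝ) : ℂ) * displacementCoeff n (k + 1) z t)
        - fun t => conj z * ((√(k : ℝ) : ℝ) : ℂ) * displacementCoeff n (k - 1) z t :=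
  funext fun t => (hasDerivAt_displacementCoeff n k z t).deriv

lemma generator_pow_succ_single (z : ℂ) (j k : ℕ) :
    (generator z ^ (j + 1)) (Finsupp.single k 1)
      = (z * ((√((k : ℝ) + 1) : ℝ) : ℂ)) • (generator z ^ j) (Finsupp.single (k + 1) 1)
        - (conj z * ((√(k : ℝ) : ℝ) : ℂ)) • (generator z ^ j) (Finsupp.single (k - 1) 1) := by
  rw [pow_succ, Module.End.mul_apply, ← map_smul, ← map_smul, ← map_sub]
  congr 1
  simp [generator, raising, lowering]

variable {H : Type*} [NormedAddCommGroup H] [InnerProductSpace ℂ H]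

/-- The Taylor coefficients of the closed form at `t = 0` are those of the exponential series. -/
lemma iteratedDeriv_displacementCoeff (b : HilbertBasis ℕ ℂ H) (z : ℂ) (n k j : ℕ) :
    iteratedDeriv j (displacementCoeff n k z) 0
      = inner ℂ (b n) (toVector b ((generator z ^ j) (Finsupp.single k 1))) := by
  induction j generalizing k with
  | zero =>
    have h : (![0, 0] : Fin 2 → ℂ) = 0 := by ext i; fin_cases i <;> rfl
    have := inner_toVector b n k 1 1
    simp only [toVector, Finsupp.linearCombination_single, one_smul] at this
    have h0 := eval_zero_displacementPoly n k
    rw [iteratedDeriv_zero, displacementCoeff, zero_mul, zero_mul, h, h0]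
    simp [toVector, this]
  | succ j ih =>
    have hc : ∀ k, ContDiffAt ℂ j (displacementCoeff n k z) 0 :=
      fun k => (differentiable_displacementCoeff n k z).contDiff.contDiffAt
    rw [iteratedDeriv_succ', deriv_displacementCoeff,
      iteratedDeriv_sub (contDiffAt_const.mul (hc _)) (contDiffAt_const.mul (hc _)),
      iteratedDeriv_const_mul_field, iteratedDeriv_const_mul_field, ih, ih,
      generator_pow_succ_single, map_sub, map_smul, map_smul, inner_sub_right, inner_smul_right,
      inner_smul_right]

/-- The closed form of the matrix elements of the shift operators: both sides are sums of the same
power series in `t` at `t = 1`. -/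
lemma inner_displacedNumberState [CompleteSpace H] (b : HilbertBasis ℕ ℂ H) (z : ℂ) (n k : ℕ) :
    inner ℂ (b n) (displacedNumberState b z k)
      = cexp (-(z * conj z / 2)) * eval ![z, conj z] (displacementPoly n k) := by
  have h1 := (innerSL ℂ (b n)).hasSum (summable_expTerm b z k).hasSum
  have h2 := hasSum_taylorSeries_of_entire (differentiable_displacementCoeff n k z) 0 1
  have h3 : displacementCoeff n k z 1
      = cexp (-(z * conj z / 2)) * eval ![z, conj z] (displacementPoly n k) := by
    simp [displacementCoeff]
  rw [← h3]
  refine h1.unique (h2.congr_fun ?_)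
  intro j
  rw [innerSL_apply_apply, expTerm, inner_smul_right,
    ← iteratedDeriv_displacementCoeff]
  simp

end MatrixElements

/-! ### Gaussian integrals of polynomials -/

lemma integrable_norm_pow_mul_exp (N : ℕ) :
    Integrable fun z : ℂ => ‖z‖ ^ N * Real.exp (-(1 / 2) * ‖z‖ ^ 2) := by
  have h := Complex.integral_rpow_mul_exp_neg_mul_rpow (p := 2) (q := N) (b := 1 / 2)
    (by norm_num) (by linarith [(Nat.cast_nonneg N : (0 : ℝ) ≤ N)]) (by norm_num)
  simp only [Real.rpow_natCast, Real.rpow_two] at h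
  -- the integral has a nonzero value, so it is not the default value of a divergent one
  refine Integrable.of_integral_ne_zero (h ▸ ?_)
  have := Real.Gamma_pos_of_pos (s := ((N : ℝ) + 2) / 2) (by positivity)
  positivity

lemma norm_cexp_neg_mul_conj (z : ℂ) : ‖cexp (-(z * conj z))‖ = Real.exp (-‖z‖ ^ 2) := by
  rw [norm_exp, mul_conj, ← ofReal_neg, ofReal_re, normSq_eq_norm_sq]

lemma eval_monomial_conj (u : Fin 2 →₀ ℕ) (a z : ℂ) :
    eval ![z, conj z] (monomial u a) = a * (z ^ u 0 * conj z ^ u 1) := by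
  rw [eval_monomial, Finsupp.prod_fintype _ _ (by simp), Fin.prod_univ_two]
  simp

@[fun_prop]
lemma continuous_eval_conj (p : MvPolynomial (Fin 2) ℂ) :
    Continuous fun z : ℂ => eval ![z, conj z] p := by
  refine (MvPolynomial.continuous_eval p).comp (continuous_pi fun i => ?_)
  fin_cases i
  · exact continuous_id
  · exact continuous_conj

/-- A Gaussian times polynomials in `z` and `z̄` remains integrable after multiplication by
`exp (c * ‖z‖)`. This gives the integrals below, and the exponential moments on which determinacy
rests. -/
lemma integrable_exp_mul_conj_eval_mul_eval (c : ℝ) (p q : MvPolynomial (Fin 2) ℂ) :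
    Integrable fun z : ℂ => (Real.exp (c * ‖z‖) : ℂ) *
      (conj (eval ![z, conj z] p) * eval ![z, conj z] q * cexp (-(z * conj z))) := by
  induction p using MvPolynomial.induction_on' with
  | add p p' hp hp' =>
    refine (hp.add hp').congr (Filter.Eventually.of_forall fun z => ?_)
    simp only [Pi.add_apply, map_add]; ring
  | monomial u a =>
    induction q using MvPolynomial.induction_on' with
    | add q q' hq hq' =>
      refine (hq.add hq').congr (Filter.Eventually.of_forall fun z => ?_)
      simp only [Pi.add_apply, map_add]; ring
    | monomial v d =>
      refine ((integrable_norm_pow_mul_exp (u 0 + u 1 + v 0 + v 1)).const_mul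
        (Real.exp (c ^ 2 / 2) * (‖a‖ * ‖d‖))).mono' (by fun_prop)
        (Filter.Eventually.of_forall fun z => ?_)
      simp only [norm_mul, norm_real, Real.norm_eq_abs, Real.abs_exp, RCLike.norm_conj,
        norm_cexp_neg_mul_conj, eval_monomial_conj, norm_pow]
      have h : Real.exp (c * ‖z‖) * Real.exp (-‖z‖ ^ 2)
          ≤ Real.exp (c ^ 2 / 2) * Real.exp (-(1 / 2) * ‖z‖ ^ 2) := by
        rw [← Real.exp_add, ← Real.exp_add, Real.exp_le_exp]
        -- completing the square: `c r ≤ (c² + r²) / 2`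
        nlinarith [sq_nonneg (c - ‖z‖)]
      calc _ = (‖a‖ * ‖d‖ * ‖z‖ ^ (u 0 + u 1 + v 0 + v 1)) *
            (Real.exp (c * ‖z‖) * Real.exp (-‖z‖ ^ 2)) := by ring
        _ ≤ (‖a‖ * ‖d‖ * ‖z‖ ^ (u 0 + u 1 + v 0 + v 1)) *
            (Real.exp (c ^ 2 / 2) * Real.exp (-(1 / 2) * ‖z‖ ^ 2)) := by gcongr
        _ = _ := by ring

lemma integrable_conj_eval_mul_eval (p q : MvPolynomial (Fin 2) ℂ) :
    Integrable fun z : ℂ =>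
      conj (eval ![z, conj z] p) * eval ![z, conj z] q * cexp (-(z * conj z)) := by
  simpa using integrable_exp_mul_conj_eval_mul_eval 0 p q

lemma integral_pow_mul_conj_pow_mul_exp (m n : ℕ) :
    ∫ z : ℂ, z ^ m * conj z ^ n * cexp (-(z * conj z))
      = if m = n then (Real.pi * n.factorial : ℂ) else 0 := by
  split_ifs with h
  · subst h
    have h := Complex.integral_rpow_mul_exp_neg_rpow (p := 2) (q := (2 * m : ℕ))
      (by norm_num) (by linarith [(Nat.cast_nonneg (2 * m) : (0 : ℝ) ≤ (2 * m : ℕ))])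
    have e : (((2 * m : ℕ) : ℝ) + 2) / 2 = m + 1 := by push_cast; ring
    rw [e, Real.Gamma_nat_eq_factorial] at h
    simp only [Real.rpow_natCast, Real.rpow_two] at h
    have h' := congrArg (fun x : ℝ => (x : ℂ)) h
    rw [← integral_complex_ofReal] at h'
    have e2 : ∀ z : ℂ, z ^ m * conj z ^ m * cexp (-(z * conj z))
        = ((‖z‖ ^ (2 * m) * Real.exp (-‖z‖ ^ 2) : ℝ) : ℂ) := fun z => by
      rw [← mul_pow, mul_conj, normSq_eq_norm_sq, pow_mul]
      push_cast; rfl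
    simp only [e2]
    refine h'.trans ?_
    push_cast; ring
  · obtain ⟨c, hc⟩ : ∃ c : Circle, (c : ℂ) ^ m * conj (c : ℂ) ^ n ≠ 1 := by
      have hmn : (m : ℂ) - n ≠ 0 := sub_ne_zero.2 (Nat.cast_injective.ne h)
      -- the rotation by `π / (m - n)` multiplies the integrand by `-1`
      refine ⟨Circle.exp (Real.pi / (m - n)), ?_⟩
      rw [Circle.coe_exp, ← Complex.exp_conj, ← Complex.exp_nat_mul, ← Complex.exp_nat_mul,
        ← Complex.exp_add]
      have e : (m : ℂ) * (((Real.pi / (m - n) : ℝ) : ℂ) * I)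
          + n * conj (((Real.pi / (m - n) : ℝ) : ℂ) * I) = Real.pi * I := by
        rw [map_mul, conj_ofReal, conj_I]
        push_cast
        field_simp
        ring
      rw [e, Complex.exp_pi_mul_I]
      norm_num
    have hr := ((rotation c).measurePreserving).integral_comp
      (rotation c).toHomeomorph.measurableEmbedding
      (fun z : ℂ => z ^ m * conj z ^ n * cexp (-(z * conj z)))
    have e : ∀ z : ℂ, (rotation c z) ^ m * conj (rotation c z) ^ n *
        cexp (-(rotation c z * conj (rotation c z)))
        = ((c : ℂ) ^ m * conj (c : ℂ) ^ n) * (z ^ m * conj z ^ n * cexp (-(z * conj z))) :=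
      fun z => by
        have hcc : (c : ℂ) * conj (c : ℂ) = 1 := by
          rw [mul_conj, Circle.normSq_coe, ofReal_one]
        have h2 : (c : ℂ) * z * (conj (c : ℂ) * conj z) = z * conj z := by
          rw [mul_mul_mul_comm, hcc, one_mul]
        rw [rotation_apply, map_mul, h2]; ring
    simp only [e] at hr
    rw [integral_const_mul] at hr
    by_contra h0
    exact hc (mul_right_cancel₀ h0 (hr.trans (one_mul _).symm))

/-- The sesquilinear form `(p, q) ↦ ∫ conj (p(z, z̄)) q(z, z̄) exp(-|z|²) dλ(z)` on polynomials. -/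
noncomputable def gaussianForm (p q : MvPolynomial (Fin 2) ℂ) : ℂ :=
  ∫ z : ℂ, conj (eval ![z, conj z] p) * eval ![z, conj z] q * cexp (-(z * conj z))

lemma gaussianForm_add_left (p p' q : MvPolynomial (Fin 2) ℂ) :
    gaussianForm (p + p') q = gaussianForm p q + gaussianForm p' q := by
  rw [gaussianForm, gaussianForm, gaussianForm, ← integral_add
    (integrable_conj_eval_mul_eval p q) (integrable_conj_eval_mul_eval p' q)]
  congr 1; ext z; simp only [map_add]; ring

lemma gaussianForm_add_right (p q q' : MvPolynomial (Fin 2) ℂ) :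
    gaussianForm p (q + q') = gaussianForm p q + gaussianForm p q' := by
  rw [gaussianForm, gaussianForm, gaussianForm, ← integral_add
    (integrable_conj_eval_mul_eval p q) (integrable_conj_eval_mul_eval p q')]
  congr 1; ext z; simp only [map_add]; ring

lemma gaussianForm_smul_left (c : ℂ) (p q : MvPolynomial (Fin 2) ℂ) :
    gaussianForm (c • p) q = conj c * gaussianForm p q := by
  rw [gaussianForm, gaussianForm, ← integral_const_mul]
  congr 1; ext z; simp only [smul_eval, map_mul]; ring

lemma gaussianForm_smul_right (c : ℂ) (p q : MvPolynomial (Fin 2) ℂ) :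
    gaussianForm p (c • q) = c * gaussianForm p q := by
  rw [gaussianForm, gaussianForm, ← integral_const_mul]
  congr 1; ext z; simp only [smul_eval]; ring

lemma gaussianForm_monomial (u v : Fin 2 →₀ ℕ) (a d : ℂ) :
    gaussianForm (monomial u a) (monomial v d) = conj a * d *
      if u 1 + v 0 = u 0 + v 1 then (Real.pi * (u 0 + v 1).factorial : ℂ) else 0 := by
  rw [← integral_pow_mul_conj_pow_mul_exp, ← integral_const_mul, gaussianForm]
  congr 1; ext z
  simp only [eval_monomial_conj, map_mul, map_pow, conj_conj]
  ring

/-- The operators `∂_z - z̄` and `-∂_z̄` are adjoint for the Gaussian form. This is integration by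
parts; on monomials it reduces to `(n + 1)! = (n + 1) n!`. -/
lemma gaussianForm_pderiv_sub (p q : MvPolynomial (Fin 2) ℂ) :
    gaussianForm p (pderiv 0 q - X 1 * q) = -gaussianForm (pderiv 1 p) q := by
  induction p using MvPolynomial.induction_on' with
  | add p p' hp hp' => simp only [map_add, gaussianForm_add_left, hp, hp']; ring
  | monomial u a =>
    induction q using MvPolynomial.induction_on' with
    | add q q' hq hq' =>
      have : pderiv 0 (q + q') - X 1 * (q + q')
          = (pderiv 0 q - X 1 * q) + (pderiv 0 q' - X 1 * q') := by simp only [map_add]; ring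
      rw [this, gaussianForm_add_right, hq, hq', gaussianForm_add_right]; ring
    | monomial v d =>
      have hX : -(X 1 * monomial v d) = monomial (Finsupp.single 1 1 + v) (-d) := by
        rw [X, monomial_mul, one_mul, map_neg]
      rw [sub_eq_add_neg, hX, gaussianForm_add_right, pderiv_monomial, pderiv_monomial,
        gaussianForm_monomial, gaussianForm_monomial, gaussianForm_monomial]
      simp only [Finsupp.coe_tsub, Finsupp.coe_add, Pi.sub_apply, Pi.add_apply,
        Finsupp.single_apply, map_mul, map_natCast, Fin.isValue, ↓reduceIte, one_ne_zero,
        zero_ne_one, zero_add, tsub_zero]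
      generalize u 0 = u0, u 1 = u1, v 0 = v0, v 1 = v1
      by_cases h : u1 + v0 = u0 + (1 + v1)
      · have h1 : u1 ≠ 0 → u1 - 1 + v0 = u0 + v1 := by omega
        have h2 : v0 ≠ 0 → u1 + (v0 - 1) = u0 + v1 := by omega
        have h3 : (u1 + v0 : ℂ) = u0 + v1 + 1 := by
          have := congrArg (Nat.cast : ℕ → ℂ) h
          push_cast at this; rw [this]; ring
        have h4 : ((u0 + (1 + v1)).factorial : ℂ) = (u1 + v0) * (u0 + v1).factorial := by
          rw [h3, show u0 + (1 + v1) = u0 + v1 + 1 by ring, Nat.factorial_succ]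
          push_cast; ring
        rw [if_pos h, h4]
        rcases eq_or_ne u1 0 with h5 | h5 <;> rcases eq_or_ne v0 0 with h6 | h6
        · omega
        · rw [if_pos (h2 h6)]; simp [h5]; ring
        · rw [if_pos (h1 h5)]; simp [h6]; ring
        · rw [if_pos (h2 h6), if_pos (h1 h5)]; ring
      · rw [if_neg h]
        have h1 : u1 ≠ 0 → u1 - 1 + v0 ≠ u0 + v1 := by omega
        have h2 : v0 ≠ 0 → u1 + (v0 - 1) ≠ u0 + v1 := by omega
        rcases eq_or_ne u1 0 with h5 | h5 <;> rcases eq_or_ne v0 0 with h6 | h6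
        · simp [h5, h6]
        · rw [if_neg (h2 h6)]; simp [h5]
        · rw [if_neg (h1 h5)]; simp [h6]
        · rw [if_neg (h2 h6), if_neg (h1 h5)]; simp

/-- The orthogonality relations: `∫ conj ⟨n, D_z k⟩ ⟨m, D_z k⟩ dλ(z) = π δ_{n,m}`. The adjoint
relation `gaussianForm_pderiv_sub` carries them from `k` to `k + 1`. -/
lemma gaussianForm_displacementPoly (n m k : ℕ) :
    gaussianForm (displacementPoly n k) (displacementPoly m k)
      = if n = m then (Real.pi : ℂ) else 0 := by
  induction k with
  | zero =>
    have h : ∀ n : ℕ, displacementPoly n 0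
        = ((√(n.factorial : ℝ) : ℝ) : ℂ)⁻¹ • monomial (Finsupp.single 0 n) 1 := fun n => by
      rw [displacementPoly, ← smul_eq_C_mul, X_pow_eq_monomial]
    rw [h, h, gaussianForm_smul_left, gaussianForm_smul_right, gaussianForm_monomial]
    simp only [Finsupp.single_apply, Fin.isValue, ↓reduceIte, zero_ne_one, zero_add, add_zero,
      map_one, one_mul, map_inv₀, conj_ofReal]
    by_cases hnm : n = m
    · subst hnm
      have h1 := ofReal_sqrt_ne_zero (x := n.factorial) (by positivity)
      have h3 := ofReal_sqrt_mul_self (x := n.factorial) (by positivity)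
      rw [if_pos rfl, if_pos rfl, show ((n.factorial : ℕ) : ℂ) = ((n.factorial : ℝ) : ℂ) by simp,
        ← h3]
      field_simp
    · rw [if_neg hnm, if_neg (Ne.symm hnm)]; simp
  | succ k ih =>
    have h2 := ofReal_sqrt_ne_zero (x := (k : ℝ) + 1) (by positivity)
    have h := gaussianForm_pderiv_sub (displacementPoly n (k + 1)) (displacementPoly m k)
    rw [← sqrt_smul_displacementPoly_succ, pderiv_one_displacementPoly, gaussianForm_smul_right,
      ← neg_smul, gaussianForm_smul_left, map_neg, neg_mul, neg_neg, conj_ofReal,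
      Nat.add_sub_cancel, ih, Nat.cast_succ] at h
    exact mul_left_cancel₀ h2 h

section Observable

/-! ### The phase space observable of a number state -/

variable {H : Type*} [NormedAddCommGroup H] [InnerProductSpace ℂ H] [CompleteSpace H]

/-- The function `z ↦ ⟨D_z s, φ⟩`, whose squared modulus is `π` times the density of `A_{φ,φ}`. -/
noncomputable def amplitude (b : HilbertBasis ℕ ℂ H) (s : ℕ) (φ : H) (z : ℂ) : ℂ :=
  inner ℂ (displacedNumberState b z s) φ

lemma inner_displacement_numberState (b : HilbertBasis ℕ ℂ H) (s : ℕ) (ψ φ : H) (z : ℂ) :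
    inner ℂ ψ (displacement b z
        (numberState b s (ContinuousLinearMap.adjoint (displacement b z) φ)))
      = conj (amplitude b s ψ z) * amplitude b s φ z := by
  rw [numberState, rankOne_apply, map_smul, inner_smul_right,
    ContinuousLinearMap.adjoint_inner_right, displacement_apply, amplitude, amplitude,
    inner_conj_symm, mul_comm]

lemma amplitude_basis (b : HilbertBasis ℕ ℂ H) (s n : ℕ) (z : ℂ) :
    amplitude b s (b n) z
      = conj (cexp (-(z * conj z / 2)) * eval ![z, conj z] (displacementPoly n s)) := by
  rw [amplitude, ← inner_conj_symm, inner_displacedNumberState]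

lemma conj_conj_mul_conj_gaussian_eval (p q : MvPolynomial (Fin 2) ℂ) (z : ℂ) :
    conj (conj (cexp (-(z * conj z / 2)) * eval ![z, conj z] p)) *
        conj (cexp (-(z * conj z / 2)) * eval ![z, conj z] q)
      = conj (eval ![z, conj z] q) * eval ![z, conj z] p * cexp (-(z * conj z)) := by
  have h : cexp (-(z * conj z)) = cexp (-(z * conj z / 2)) * cexp (-(z * conj z / 2)) := by
    rw [← Complex.exp_add]; ring_nf
  have h2 : conj (cexp (-(z * conj z / 2))) = cexp (-(z * conj z / 2)) := by
    rw [← exp_conj, map_neg, map_div₀, map_mul, conj_conj, mul_comm, map_ofNat]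
  rw [conj_conj, map_mul, h2, h]
  ring

lemma continuous_conj_gaussian_eval (p : MvPolynomial (Fin 2) ℂ) :
    Continuous fun z : ℂ => conj (cexp (-(z * conj z / 2)) * eval ![z, conj z] p) := by
  fun_prop

lemma memLp_conj_gaussian_eval (p : MvPolynomial (Fin 2) ℂ) :
    MemLp (fun z : ℂ => conj (cexp (-(z * conj z / 2)) * eval ![z, conj z] p)) 2 volume := by
  rw [memLp_two_iff_integrable_sq_norm (continuous_conj_gaussian_eval p).aestronglyMeasurable]
  refine (integrable_conj_eval_mul_eval p p).norm.congr (Filter.Eventually.of_forall fun z => ?_)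
  beta_reduce
  rw [← conj_conj_mul_conj_gaussian_eval, norm_mul, RCLike.norm_conj, ← sq]

lemma exists_amplitude_eq_of_mem_span (b : HilbertBasis ℕ ℂ H) (s : ℕ) {φ : H}
    (hφ : φ ∈ numberSpan b) : ∃ p : MvPolynomial (Fin 2) ℂ, ∀ z, amplitude b s φ z
      = conj (cexp (-(z * conj z / 2)) * eval ![z, conj z] p) := by
  induction hφ using Submodule.span_induction with
  | mem x hx =>
    obtain ⟨n, rfl⟩ := hx
    exact ⟨displacementPoly n s, amplitude_basis b s n⟩
  | zero => exact ⟨0, fun z => by simp [amplitude]⟩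
  | add x y _ _ hx hy =>
    obtain ⟨p, hp⟩ := hx
    obtain ⟨q, hq⟩ := hy
    refine ⟨p + q, fun z => ?_⟩
    rw [map_add, mul_add, map_add, ← hp, ← hq, amplitude, inner_add_right]
    rfl
  | smul c x _ hx =>
    obtain ⟨p, hp⟩ := hx
    refine ⟨conj c • p, fun z => ?_⟩
    rw [smul_eval, mul_left_comm, map_mul, ← hp, conj_conj, amplitude, inner_smul_right]
    rfl

lemma integral_conj_amplitude_mul_amplitude_basis (b : HilbertBasis ℕ ℂ H) (s n m : ℕ) :
    ∫ z, conj (amplitude b s (b n) z) * amplitude b s (b m) z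
      = if n = m then (Real.pi : ℂ) else 0 := by
  simp only [amplitude_basis, conj_conj_mul_conj_gaussian_eval]
  rw [show (if n = m then (Real.pi : ℂ) else 0) = if m = n then (Real.pi : ℂ) else 0 by
    simp only [eq_comm]]
  exact gaussianForm_displacementPoly m n s

lemma memLp_amplitude_basis (b : HilbertBasis ℕ ℂ H) (s n : ℕ) :
    MemLp (amplitude b s (b n)) 2 volume := by
  rw [funext (amplitude_basis b s n)]
  exact memLp_conj_gaussian_eval _

/-- The class in `L²(ℂ)` of the normalized function `z ↦ ⟨D_z s, n⟩ / √π`. -/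
noncomputable def amplitudeLp (b : HilbertBasis ℕ ℂ H) (s n : ℕ) : Lp ℂ 2 (volume : Measure ℂ) :=
  ((√Real.pi : ℝ) : ℂ)⁻¹ • (memLp_amplitude_basis b s n).toLp

lemma orthonormal_amplitudeLp (b : HilbertBasis ℕ ℂ H) (s : ℕ) :
    Orthonormal ℂ (amplitudeLp b s) := by
  rw [orthonormal_iff_ite]
  intro n m
  rw [amplitudeLp, amplitudeLp, inner_smul_left, inner_smul_right, L2.inner_def]
  have h : ∫ z, inner ℂ ((memLp_amplitude_basis b s n).toLp _ z)
      ((memLp_amplitude_basis b s m).toLp _ z) = if n = m then (Real.pi : ℂ) else 0 := by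
    rw [← integral_conj_amplitude_mul_amplitude_basis b s n m]
    refine integral_congr_ae ?_
    filter_upwards [(memLp_amplitude_basis b s n).coeFn_toLp,
      (memLp_amplitude_basis b s m).coeFn_toLp] with z h1 h2
    rw [h1, h2, RCLike.inner_apply, mul_comm]
  have h1 := ofReal_sqrt_ne_zero Real.pi_pos
  have h2 := ofReal_sqrt_mul_self Real.pi_pos.le
  rw [h, map_inv₀, conj_ofReal]
  split_ifs
  · rw [← h2]; field_simp
  · simp

/-- The isometry `φ ↦ (z ↦ ⟨D_z s, φ⟩ / √π)` from `H` into `L²(ℂ)`, defined by its values on the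
number states; `amplitudeIsometry_ae_eq` shows that it has this form for every `φ`. -/
noncomputable def amplitudeIsometry (b : HilbertBasis ℕ ℂ H) (s : ℕ) :
    H →ₗᵢ[ℂ] Lp ℂ 2 (volume : Measure ℂ) :=
  (orthonormal_amplitudeLp b s).orthogonalFamily.linearIsometry.comp b.repr.toLinearIsometry

lemma amplitudeIsometry_basis (b : HilbertBasis ℕ ℂ H) (s n : ℕ) :
    amplitudeIsometry b s (b n) = amplitudeLp b s n := by
  classical
  simp [amplitudeIsometry, OrthogonalFamily.linearIsometry_apply_single, b.repr_self]

lemma amplitudeIsometry_ae_eq_of_mem_span (b : HilbertBasis ℕ ℂ H) (s : ℕ) {φ : H}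
    (hφ : φ ∈ numberSpan b) :
    amplitudeIsometry b s φ =ᵐ[volume]
      fun z => ((√Real.pi : ℝ) : ℂ)⁻¹ * amplitude b s φ z := by
  induction hφ using Submodule.span_induction with
  | mem x hx =>
    obtain ⟨n, rfl⟩ := hx
    rw [amplitudeIsometry_basis, amplitudeLp]
    filter_upwards [Lp.coeFn_smul (((√Real.pi : ℝ) : ℂ)⁻¹) ((memLp_amplitude_basis b s n).toLp),
      (memLp_amplitude_basis b s n).coeFn_toLp] with z h1 h2
    rw [h1, Pi.smul_apply, h2, smul_eq_mul]
  | zero =>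
    rw [map_zero]
    filter_upwards [Lp.coeFn_zero ℂ 2 (volume : Measure ℂ)] with z h
    simp [amplitude]
  | add x y _ _ hx hy =>
    rw [map_add]
    filter_upwards [Lp.coeFn_add (amplitudeIsometry b s x) (amplitudeIsometry b s y), hx, hy]
      with z h h1 h2
    rw [h, Pi.add_apply, h1, h2, amplitude, amplitude, amplitude, inner_add_right, mul_add]
  | smul c x _ hx =>
    rw [map_smul]
    filter_upwards [Lp.coeFn_smul c (amplitudeIsometry b s x), hx] with z h h1
    rw [h, Pi.smul_apply, h1, amplitude, amplitude, inner_smul_right, smul_eq_mul, mul_left_comm]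

lemma amplitudeIsometry_ae_eq (b : HilbertBasis ℕ ℂ H) (s : ℕ) (φ : H) :
    amplitudeIsometry b s φ =ᵐ[volume]
      fun z => ((√Real.pi : ℝ) : ℂ)⁻¹ * amplitude b s φ z := by
  have hd : φ ∈ closure (numberSpan b : Set H) := by
    have := b.dense_span
    rw [← Submodule.topologicalClosure_coe, numberSpan, this]
    trivial
  obtain ⟨x, hx, hlim⟩ := mem_closure_iff_seq_limit.1 hd
  have h1 : Filter.Tendsto (fun n => amplitudeIsometry b s (x n)) Filter.atTop
      (nhds (amplitudeIsometry b s φ)) :=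
    ((amplitudeIsometry b s).continuous.tendsto φ).comp hlim
  -- along a subsequence, convergence in `L²` is convergence almost everywhere
  obtain ⟨u, hu, hae⟩ := (tendstoInMeasure_of_tendsto_Lp h1).exists_seq_tendsto_ae
  have h2 : ∀ᵐ z, ∀ n, amplitudeIsometry b s (x n) z
      = ((√Real.pi : ℝ) : ℂ)⁻¹ * amplitude b s (x n) z :=
    ae_all_iff.2 fun n => amplitudeIsometry_ae_eq_of_mem_span b s (hx n)
  filter_upwards [hae, h2] with z hz hz2
  refine tendsto_nhds_unique hz ?_
  simp only [hz2]
  refine Filter.Tendsto.const_mul _ ?_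
  exact ((innerSL ℂ (displacedNumberState b z s)).continuous.tendsto φ).comp
    (hlim.comp hu.tendsto_atTop)

lemma amplitude_ae_eq (b : HilbertBasis ℕ ℂ H) (s : ℕ) (φ : H) :
    amplitude b s φ =ᵐ[volume]
      fun z => ((√Real.pi : ℝ) : ℂ) * amplitudeIsometry b s φ z := by
  filter_upwards [amplitudeIsometry_ae_eq b s φ] with z hz
  rw [hz, mul_inv_cancel_left₀ (ofReal_sqrt_ne_zero Real.pi_pos)]

lemma memLp_amplitude (b : HilbertBasis ℕ ℂ H) (s : ℕ) (φ : H) :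
    MemLp (amplitude b s φ) 2 volume :=
  ((Lp.memLp (amplitudeIsometry b s φ)).const_mul _).ae_eq (amplitude_ae_eq b s φ).symm

lemma integrable_conj_amplitude_mul_amplitude (b : HilbertBasis ℕ ℂ H) (s : ℕ) (ψ φ : H) :
    Integrable fun z => conj (amplitude b s ψ z) * amplitude b s φ z :=
  (memLp_amplitude b s ψ).star.integrable_mul (memLp_amplitude b s φ)

/-- The operator `π⁻¹ ∫_Z D_z |s⟩⟨s| D_z^* dλ(z)`, as `R^* R` with `R φ` the restriction to `Z` of
`z ↦ ⟨D_z s, φ⟩ / √π`. -/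
noncomputable def effect (b : HilbertBasis ℕ ℂ H) (s : ℕ) (Z : Set ℂ) : H →L[ℂ] H :=
  let R := (LpToLpRestrictCLM ℂ ℂ ℂ volume 2 Z).comp
    (amplitudeIsometry b s).toContinuousLinearMap
  (ContinuousLinearMap.adjoint R).comp R

lemma isPositive_effect (b : HilbertBasis ℕ ℂ H) (s : ℕ) (Z : Set ℂ) :
    (effect b s Z).IsPositive :=
  ContinuousLinearMap.isPositive_adjoint_comp_self _

lemma inner_effect (b : HilbertBasis ℕ ℂ H) (s : ℕ) (Z : Set ℂ) (ψ φ : H) :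
    inner ℂ ψ (effect b s Z φ)
      = (Real.pi : ℂ)⁻¹ * ∫ z in Z, conj (amplitude b s ψ z) * amplitude b s φ z := by
  rw [effect, ContinuousLinearMap.comp_apply, ContinuousLinearMap.adjoint_inner_right,
    L2.inner_def, ← integral_const_mul]
  refine integral_congr_ae ?_
  have h2 := ofReal_sqrt_mul_self Real.pi_pos.le
  filter_upwards [LpToLpRestrictCLM_coeFn ℂ Z (amplitudeIsometry b s ψ),
    LpToLpRestrictCLM_coeFn ℂ Z (amplitudeIsometry b s φ),
    ae_restrict_of_ae (amplitudeIsometry_ae_eq b s ψ),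
    ae_restrict_of_ae (amplitudeIsometry_ae_eq b s φ)] with z h3 h4 h5 h6
  simp only [ContinuousLinearMap.comp_apply, LinearIsometry.coe_toContinuousLinearMap]
  rw [h3, h4, h5, h6, RCLike.inner_apply, map_mul, map_inv₀, conj_ofReal, ← h2, mul_inv]
  ring

lemma effect_univ (b : HilbertBasis ℕ ℂ H) (s : ℕ) : effect b s Set.univ = 1 := by
  ext φ
  refine ext_inner_left ℂ fun ψ => ?_
  have h2 := ofReal_sqrt_mul_self Real.pi_pos.le
  rw [inner_effect, setIntegral_univ, one_apply_eq_self,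
    ← (amplitudeIsometry b s).inner_map_map ψ φ, L2.inner_def, ← integral_const_mul]
  refine integral_congr_ae ?_
  filter_upwards [amplitudeIsometry_ae_eq b s ψ, amplitudeIsometry_ae_eq b s φ] with z h5 h6
  rw [h5, h6, RCLike.inner_apply, map_mul, map_inv₀, conj_ofReal, ← h2, mul_inv]
  ring

open Classical in
/-- The phase space observable generated by the number state `|s⟩`. -/
noncomputable def numberStateObservable (b : HilbertBasis ℕ ℂ H) (s : ℕ) :
    PositiveOperatorMeasure H where
  toFun Z := if MeasurableSet Z then effect b s Z else 0
  not_measurable' Z hZ := if_neg hZ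
  isPositive' Z hZ := by rw [if_pos hZ]; exact isPositive_effect b s Z
  map_univ' := by rw [if_pos MeasurableSet.univ, effect_univ]
  hasSum' Z hZ hd ψ φ := by
    simp only [if_pos (hZ _), if_pos (MeasurableSet.iUnion hZ), inner_effect]
    exact (hasSum_integral_iUnion hZ hd
      (integrable_conj_amplitude_mul_amplitude b s ψ φ).integrableOn).mul_left _

lemma isPhaseSpaceObservable_numberState_iff (b : HilbertBasis ℕ ℂ H) (s : ℕ)
    (A : PositiveOperatorMeasure H) :
    IsPhaseSpaceObservable b (numberState b s) A ↔
      ∀ ψ φ : H, ∀ Z : Set ℂ, MeasurableSet Z → inner ℂ ψ (A Z φ)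
        = (Real.pi : ℂ)⁻¹ * ∫ z in Z, conj (amplitude b s ψ z) * amplitude b s φ z := by
  simp only [IsPhaseSpaceObservable, inner_displacement_numberState,
    integrable_conj_amplitude_mul_amplitude, true_and]

lemma isPhaseSpaceObservable_numberStateObservable (b : HilbertBasis ℕ ℂ H) (s : ℕ) :
    IsPhaseSpaceObservable b (numberState b s) (numberStateObservable b s) := by
  rw [isPhaseSpaceObservable_numberState_iff]
  intro ψ φ Z hZ
  rw [← inner_effect, numberStateObservable]
  simp only [if_pos hZ]

lemma IsPhaseSpaceObservable.unique {b : HilbertBasis ℕ ℂ H} {T : H →L[ℂ] H}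
    {A B : PositiveOperatorMeasure H} (hA : IsPhaseSpaceObservable b T A)
    (hB : IsPhaseSpaceObservable b T B) : A = B := by
  ext Z hZ φ
  refine ext_inner_left ℂ fun ψ => ?_
  rw [(hA ψ φ).2 Z hZ, (hB ψ φ).2 Z hZ]

end Observable

/-! ### Determinacy of measures with exponential moments -/

lemma integrable_pow_mul_conj_pow_of_integrable_exp {μ : Measure ℂ}
    (hμ : Integrable (fun z : ℂ => Real.exp ‖z‖) μ) (m n : ℕ) :
    Integrable (fun z : ℂ => z ^ m * conj z ^ n) μ := by
  refine (hμ.const_mul ((m + n).factorial : ℝ)).mono' (by fun_prop)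
    (Filter.Eventually.of_forall fun z => ?_)
  rw [norm_mul, norm_pow, norm_pow, RCLike.norm_conj, ← pow_add]
  have := Real.pow_div_factorial_le_exp ‖z‖ (norm_nonneg z) (m + n)
  rwa [div_le_iff₀' (by positivity)] at this

/-- The integral of `cosh (c * ‖z‖)` depends only on the even absolute moments. -/
lemma lintegral_cosh_norm (μ : Measure ℂ) (c : ℝ) :
    ∫⁻ z, ENNReal.ofReal (Real.cosh (c * ‖z‖)) ∂μ
      = ∑' k : ℕ, ENNReal.ofReal (c ^ (2 * k) / (2 * k).factorial) *
          ∫⁻ z, ENNReal.ofReal (‖z‖ ^ (2 * k)) ∂μ := by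
  have hc : ∀ k : ℕ, 0 ≤ c ^ (2 * k) / (2 * k).factorial := fun k => by
    rw [pow_mul]; positivity
  have h : ∀ z : ℂ, ENNReal.ofReal (Real.cosh (c * ‖z‖))
      = ∑' k : ℕ, ENNReal.ofReal (c ^ (2 * k) / (2 * k).factorial) *
          ENNReal.ofReal (‖z‖ ^ (2 * k)) := fun z => by
    rw [← (Real.hasSum_cosh (c * ‖z‖)).tsum_eq, ENNReal.ofReal_tsum_of_nonneg
      (fun k => by rw [pow_mul]; positivity) (Real.hasSum_cosh _).summable]
    refine tsum_congr fun k => ?_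
    rw [← ENNReal.ofReal_mul (hc k), mul_pow, div_mul_eq_mul_div]
  simp only [h]
  rw [lintegral_tsum fun k => by fun_prop]
  exact tsum_congr fun k => lintegral_const_mul _ (by fun_prop)

lemma integrable_exp_of_moments_eq {μ ν : Measure ℂ}
    (hμ : ∀ c : ℝ, Integrable (fun z : ℂ => Real.exp (c * ‖z‖)) μ)
    (hν : ∀ m n : ℕ, Integrable (fun z : ℂ => z ^ m * conj z ^ n) ν)
    (h : ∀ m n : ℕ, ∫ z, z ^ m * conj z ^ n ∂ν = ∫ z, z ^ m * conj z ^ n ∂μ) (c : ℝ) :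
    Integrable (fun z : ℂ => Real.exp (c * ‖z‖)) ν := by
  have e : ∀ (k : ℕ) (z : ℂ), z ^ k * conj z ^ k = ((‖z‖ ^ (2 * k) : ℝ) : ℂ) := fun k z => by
    rw [← mul_pow, mul_conj, normSq_eq_norm_sq, pow_mul]; push_cast; rfl
  have hμ' : ∀ m n : ℕ, Integrable (fun z : ℂ => z ^ m * conj z ^ n) μ :=
    integrable_pow_mul_conj_pow_of_integrable_exp (by simpa using hμ 1)
  have hpow : ∀ k : ℕ, ∫⁻ z : ℂ, ENNReal.ofReal (‖z‖ ^ (2 * k)) ∂ν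
      = ∫⁻ z : ℂ, ENNReal.ofReal (‖z‖ ^ (2 * k)) ∂μ := fun k => by
    have h1 := h k k
    have h2 := hν k k
    have h3 := hμ' k k
    simp only [e] at h1 h2 h3
    rw [integral_complex_ofReal, integral_complex_ofReal, ofReal_inj] at h1
    have h2' : Integrable (fun z : ℂ => ‖z‖ ^ (2 * k)) ν := by
      simpa only [RCLike.re_to_complex, ofReal_re] using h2.re
    have h3' : Integrable (fun z : ℂ => ‖z‖ ^ (2 * k)) μ := by
      simpa only [RCLike.re_to_complex, ofReal_re] using h3.re
    rw [← ofReal_integral_eq_lintegral_ofReal h2'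
        (Filter.Eventually.of_forall fun z => by positivity),
      ← ofReal_integral_eq_lintegral_ofReal h3'
        (Filter.Eventually.of_forall fun z => by positivity), h1]
  -- `cosh` is an even series, and `‖z‖ ^ (2 * k) = z ^ k * z̄ ^ k` is one of the given moments
  have hcosh : Integrable (fun z : ℂ => Real.cosh (c * ‖z‖)) ν := by
    have hm : Integrable (fun z : ℂ => Real.cosh (c * ‖z‖)) μ := by
      refine (((hμ c).add (hμ (-c))).div_const 2).congr (Filter.Eventually.of_forall fun z => ?_)
      simp [Real.cosh_eq]
    refine ⟨by fun_prop, ?_⟩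
    rw [hasFiniteIntegral_iff_ofReal (Filter.Eventually.of_forall fun z => (Real.cosh_pos _).le)]
    rw [lintegral_cosh_norm]
    simp only [hpow]
    rw [← lintegral_cosh_norm]
    exact (hasFiniteIntegral_iff_ofReal
      (Filter.Eventually.of_forall fun z => (Real.cosh_pos _).le)).1 hm.2
  -- `exp x ≤ 2 cosh x`
  refine (hcosh.const_mul 2).mono' (by fun_prop) (Filter.Eventually.of_forall fun z => ?_)
  rw [Real.norm_eq_abs, Real.abs_exp, Real.cosh_eq]
  linarith [Real.exp_pos (-(c * ‖z‖))]

/-- With all exponential moments, the characteristic function is the sum of its moment series. -/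
lemma hasSum_charFun {μ : Measure ℂ}
    (hμ : ∀ c : ℝ, Integrable (fun z : ℂ => Real.exp (c * ‖z‖)) μ) (w : ℂ) :
    HasSum (fun k : ℕ => ∫ z, ((k.factorial : ℂ)⁻¹ * ((inner ℝ z w : ℝ) * I) ^ k) ∂μ)
      (charFun μ w) := by
  rw [charFun_apply]
  have hs : ∀ x : ℝ, HasSum (fun k : ℕ => ((k.factorial : ℝ)⁻¹ * x ^ k)) (Real.exp x) := fun x => by
    have := NormedSpace.exp_series_hasSum_exp' (𝕂 := ℝ) x
    rwa [← Real.exp_eq_exp_ℝ] at this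
  refine hasSum_integral_of_dominated_convergence
    (fun k z => (k.factorial : ℝ)⁻¹ * (‖w‖ * ‖z‖) ^ k) (fun k => by fun_prop)
    (fun k => Filter.Eventually.of_forall fun z => ?_)
    (Filter.Eventually.of_forall fun z => (hs _).summable) ?_
    (Filter.Eventually.of_forall fun z => ?_)
  · rw [norm_mul, norm_inv, norm_natCast, norm_pow, norm_mul, norm_I, mul_one, norm_real]
    gcongr
    rw [mul_comm]
    exact norm_inner_le_norm z w
  · simp only [(hs _).tsum_eq]
    exact hμ _
  · have := NormedSpace.exp_series_hasSum_exp' (𝕂 := ℂ) ((inner ℝ z w : ℝ) * I : ℂ)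
    rwa [← Complex.exp_eq_exp_ℂ] at this

lemma ofReal_inner_mul_I_pow (z w : ℂ) (k : ℕ) :
    ((inner ℝ z w : ℝ) * I) ^ k = ∑ j ∈ Finset.range (k + 1),
      ((conj w * I / 2) ^ j * (w * I / 2) ^ (k - j) * (k.choose j : ℂ)) *
        (z ^ j * conj z ^ (k - j)) := by
  have h : ((inner ℝ z w : ℝ) : ℂ) * I = (conj w * I / 2) * z + (w * I / 2) * conj z := by
    rw [Complex.inner, re_eq_add_conj, map_mul, conj_conj]
    ring
  rw [h, add_pow]
  refine Finset.sum_congr rfl fun j _ => ?_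
  rw [mul_pow, mul_pow]
  ring

/-- A finite measure on `ℂ` with exponential moments of all orders is determined by its moments. -/
theorem eq_of_moments_eq {μ ν : Measure ℂ} [IsFiniteMeasure μ] [IsFiniteMeasure ν]
    (hμ : ∀ c : ℝ, Integrable (fun z : ℂ => Real.exp (c * ‖z‖)) μ)
    (hν : ∀ m n : ℕ, Integrable (fun z : ℂ => z ^ m * conj z ^ n) ν)
    (h : ∀ m n : ℕ, ∫ z, z ^ m * conj z ^ n ∂ν = ∫ z, z ^ m * conj z ^ n ∂μ) : ν = μ := by
  have hμ' : ∀ m n : ℕ, Integrable (fun z : ℂ => z ^ m * conj z ^ n) μ :=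
    integrable_pow_mul_conj_pow_of_integrable_exp (by simpa using hμ 1)
  refine Measure.ext_of_charFun (funext fun w => ?_)
  refine (hasSum_charFun (integrable_exp_of_moments_eq hμ hν h) w).unique ?_
  refine (hasSum_charFun hμ w).congr_fun fun k => ?_
  rw [integral_const_mul, integral_const_mul]
  congr 1
  simp only [ofReal_inner_mul_I_pow]
  rw [integral_finsetSum _ fun j _ => (hν _ _).const_mul _,
    integral_finsetSum _ fun j _ => (hμ' _ _).const_mul _]
  simp only [integral_const_mul, h]

/-! ### Diagonal measures of an operator measure -/

namespace PositiveOperatorMeasure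

variable {H : Type*} [NormedAddCommGroup H] [InnerProductSpace ℂ H]
  (E : PositiveOperatorMeasure H)

lemma inner_self_eq_re (Z : Set ℂ) (φ : H) :
    inner ℂ φ (E Z φ) = (RCLike.re (inner ℂ φ (E Z φ)) : ℂ) := by
  have h := (E.isPositive Z).inner_nonneg_right φ
  rw [Complex.nonneg_iff] at h
  exact Complex.ext (by simp) (by simp [← h.2])

/-- The complex measure `E_{φ,φ}` is positive, so that its total variation is `E_{φ,φ}` itself. -/
lemma variation_complexMeasure_self (φ : H) {Z : Set ℂ} (hZ : MeasurableSet Z) :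
    (E.complexMeasure φ φ).variation Z = ENNReal.ofReal (RCLike.re (inner ℂ φ (E Z φ))) := by
  have hpos : ∀ Z, 0 ≤ RCLike.re (inner ℂ φ (E Z φ)) :=
    fun Z => (E.isPositive Z).re_inner_nonneg_right φ
  have hnorm : ∀ Z, ‖E.complexMeasure φ φ Z‖ₑ = ENNReal.ofReal (RCLike.re (inner ℂ φ (E Z φ))) :=
    fun Z => by
      have h := congrArg (‖·‖ₑ) (E.inner_self_eq_re Z φ)
      rw [complexMeasure_apply]
      refine h.trans ?_
      rw [← ofReal_norm, norm_real, Real.norm_of_nonneg (hpos Z)]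
  let m : Measure ℂ := Measure.ofMeasurable
    (fun Z _ => ENNReal.ofReal (RCLike.re (inner ℂ φ (E Z φ)))) (by simp [E.map_empty])
    (fun f hf hd => by
      have h := (RCLike.reCLM (K := ℂ)).hasSum (E.hasSum' f hf hd φ φ)
      simp only [RCLike.reCLM_apply] at h
      rw [← h.tsum_eq, ENNReal.ofReal_tsum_of_nonneg (fun i => hpos (f i)) h.summable])
  refine le_antisymm ?_ ((hnorm Z).symm.le.trans (VectorMeasure.enorm_measure_le_variation _ Z))
  have hm : (E.complexMeasure φ φ).variation ≤ m :=
    VectorMeasure.variation_le_of_forall_enorm_le fun s hs => by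
      rw [Measure.ofMeasurable_apply s hs, hnorm]
  exact (hm Z).trans (Measure.ofMeasurable_apply Z hZ).le

lemma complexIntegral_complexMeasure_self (φ : H) (f : ℂ → ℂ) :
    complexIntegral (E.complexMeasure φ φ) f = ∫ z, f z ∂(E.complexMeasure φ φ).variation := by
  rw [complexIntegral, VectorMeasure.integral_eq_setToFun, MeasureTheory.integral_eq_setToFun]
  refine setToFun_congr_left' _ _ (fun s hs _ => ?_) _
  ext x
  change x * inner ℂ φ (E s φ) = (E.complexMeasure φ φ).variation.real s • x
  rw [measureReal_def, variation_complexMeasure_self E φ hs,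
    ENNReal.toReal_ofReal ((E.isPositive s).re_inner_nonneg_right φ), real_smul, mul_comm,
    inner_self_eq_re]
  simp

/-- Polarization: an operator measure is determined by the measures `E_{φ,φ}` for `φ` in a dense
set. -/
lemma eq_of_inner_self_eq_of_dense {E F : PositiveOperatorMeasure H} {S : Set H} (hS : Dense S)
    (h : ∀ φ ∈ S, ∀ Z, MeasurableSet Z → inner ℂ φ (E Z φ) = inner ℂ φ (F Z φ)) : E = F := by
  ext Z hZ : 1
  have h1 : ∀ φ : H, inner ℂ φ (E Z φ) = inner ℂ φ (F Z φ) := fun φ =>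
    congrFun (Continuous.ext_on hS (f := fun φ => inner ℂ φ (E Z φ))
      (g := fun φ => inner ℂ φ (F Z φ)) (by fun_prop) (by fun_prop) fun φ hφ => h φ hφ Z hZ) φ
  have h2 := (inner_map_self_eq_zero ((E Z - F Z : H →L[ℂ] H) : H →ₗ[ℂ] H)).1 fun φ => by
    rw [← inner_conj_symm]
    simp [inner_sub_right, h1]
  exact sub_eq_zero.1 (ContinuousLinearMap.coe_injective h2)

end PositiveOperatorMeasure

section Determinacy

/-! ### Moments and determinacy of the observable -/

variable {H : Type*} [NormedAddCommGroup H] [InnerProductSpace ℂ H] [CompleteSpace H]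

/-- The total variation of `A_{ψ,φ}` is at most `π⁻¹ |⟨ψ, D_z s⟩ ⟨D_z s, φ⟩|` times the Lebesgue
measure, which yields integrability. -/
lemma integrable_complexMeasure {b : HilbertBasis ℕ ℂ H} {s : ℕ} {A : PositiveOperatorMeasure H}
    (hA : IsPhaseSpaceObservable b (numberState b s) A) {f : ℂ → ℂ} (hf : Measurable f) {ψ φ : H}
    (h : Integrable fun z => f z * (conj (amplitude b s ψ z) * amplitude b s φ z)) :
    (A.complexMeasure ψ φ).Integrable f := by
  rw [isPhaseSpaceObservable_numberState_iff] at hA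
  set d : ℂ → ℂ := fun z => (Real.pi : ℂ)⁻¹ * (conj (amplitude b s ψ z) * amplitude b s φ z) with hd
  have hdm : AEStronglyMeasurable d volume :=
    (integrable_conj_amplitude_mul_amplitude b s ψ φ).aestronglyMeasurable.const_mul _
  have hle : (A.complexMeasure ψ φ).variation ≤ volume.withDensity fun z => ‖d z‖ₑ := by
    refine VectorMeasure.variation_le_of_forall_enorm_le fun Z hZ => ?_
    rw [withDensity_apply _ hZ, PositiveOperatorMeasure.complexMeasure_apply, hA ψ φ Z hZ,
      ← integral_const_mul]
    exact enorm_integral_le_lintegral_enorm _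
  refine Integrable.mono_measure ⟨hf.aestronglyMeasurable, ?_⟩ hle
  rw [HasFiniteIntegral, lintegral_withDensity_eq_lintegral_mul₀ hdm.enorm hf.enorm.aemeasurable]
  have h' := (h.const_mul (Real.pi : ℂ)⁻¹).2
  rw [HasFiniteIntegral] at h'
  refine lt_of_le_of_lt (lintegral_mono fun z => ?_) h'
  rw [Pi.mul_apply, ← enorm_mul, hd]
  refine le_of_eq (congrArg _ ?_)
  ring

lemma numberSpan_le_domain_moment {b : HilbertBasis ℕ ℂ H} {s : ℕ} {A : PositiveOperatorMeasure H}
    (hA : IsPhaseSpaceObservable b (numberState b s) A) (m n : ℕ) :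
    numberSpan b ≤ (A.moment m n).domain := by
  intro φ hφ ψ
  refine integrable_complexMeasure hA (by fun_prop) ?_
  obtain ⟨p, hp⟩ := exists_amplitude_eq_of_mem_span b s hφ
  refine ((memLp_amplitude b s ψ).star.integrable_mul
    (memLp_conj_gaussian_eval (X 1 ^ m * X 0 ^ n * p))).congr
      (Filter.Eventually.of_forall fun z => ?_)
  simp only [Pi.mul_apply, Pi.star_apply, RCLike.star_def, hp, map_mul, map_pow, eval_X,
    Matrix.cons_val_one, Matrix.cons_val_zero, Matrix.cons_val_fin_one, conj_conj]
  ring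

/-- The measure `A_{φ,φ}` has exponential moments of all orders if `φ` is in the span of the number
states. -/
lemma integrable_exp_variation {b : HilbertBasis ℕ ℂ H} {s : ℕ} {A : PositiveOperatorMeasure H}
    (hA : IsPhaseSpaceObservable b (numberState b s) A) {φ : H} (hφ : φ ∈ numberSpan b) (c : ℝ) :
    Integrable (fun z : ℂ => Real.exp (c * ‖z‖)) (A.complexMeasure φ φ).variation := by
  obtain ⟨p, hp⟩ := exists_amplitude_eq_of_mem_span b s hφ
  have h : (A.complexMeasure φ φ).Integrable fun z => (Real.exp (c * ‖z‖) : ℂ) := by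
    refine integrable_complexMeasure hA (by fun_prop) ?_
    simp only [hp, conj_conj_mul_conj_gaussian_eval]
    exact integrable_exp_mul_conj_eval_mul_eval c p p
  simpa only [RCLike.re_to_complex, ofReal_re] using Integrable.re h

theorem eq_of_moment_domRestrict_eq {b : HilbertBasis ℕ ℂ H} {s : ℕ}
    {A E : PositiveOperatorMeasure H} (hA : IsPhaseSpaceObservable b (numberState b s) A)
    (h : ∀ m n : ℕ, (E.moment m n).domRestrict (numberSpan b)
      = (A.moment m n).domRestrict (numberSpan b)) : E = A := by
  have hdom : ∀ m n, numberSpan b ≤ (E.moment m n).domain := fun m n => by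
    have h1 := congrArg LinearPMap.domain (h m n)
    rw [LinearPMap.domRestrict_domain, LinearPMap.domRestrict_domain,
      inf_eq_left.2 (numberSpan_le_domain_moment hA m n)] at h1
    exact inf_eq_left.1 h1
  have hdense : Dense (numberSpan b : Set H) :=
    Submodule.dense_iff_topologicalClosure_eq_top.2 b.dense_span
  refine PositiveOperatorMeasure.eq_of_inner_self_eq_of_dense hdense fun φ hφ Z hZ => ?_
  have hmom : ∀ m n : ℕ, ∫ z, z ^ m * conj z ^ n ∂(E.complexMeasure φ φ).variation
      = ∫ z, z ^ m * conj z ^ n ∂(A.complexMeasure φ φ).variation := fun m n => by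
    have hval : E.moment m n ⟨φ, hdom m n hφ⟩
        = A.moment m n ⟨φ, numberSpan_le_domain_moment hA m n hφ⟩ :=
      (LinearPMap.ext_iff.1 (h m n)).2 (x := φ) (hf := ⟨hφ, hdom m n hφ⟩)
        (hg := ⟨hφ, numberSpan_le_domain_moment hA m n hφ⟩)
    rw [← PositiveOperatorMeasure.complexIntegral_complexMeasure_self,
      ← PositiveOperatorMeasure.complexIntegral_complexMeasure_self]
    refine Eq.trans (E.inner_operatorIntegral _ (by fun_prop) ⟨φ, hdom m n hφ⟩ φ).symm ?_
    exact (congrArg (inner ℂ φ) hval).trans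
      (A.inner_operatorIntegral _ (by fun_prop) ⟨φ, numberSpan_le_domain_moment hA m n hφ⟩ φ)
  have hvar := eq_of_moments_eq (integrable_exp_variation hA hφ)
    (fun m n => hdom m n hφ φ) hmom
  have hZ' := congrArg (fun μ : Measure ℂ => μ Z) hvar
  simp only [PositiveOperatorMeasure.variation_complexMeasure_self _ _ hZ] at hZ'
  rw [ENNReal.ofReal_eq_ofReal_iff ((E.isPositive Z).re_inner_nonneg_right φ)
    ((A.isPositive Z).re_inner_nonneg_right φ)] at hZ'
  rw [E.inner_self_eq_re, A.inner_self_eq_re, hZ']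

end Determinacy

end PhaseSpace

theorem mainTheorem4 {H : Type*} [NormedAddCommGroup H] [InnerProductSpace ℂ H] [CompleteSpace H]
    (b : HilbertBasis ℕ ℂ H) (s : ℕ) :
    (∃! A : PhaseSpace.PositiveOperatorMeasure H,
      PhaseSpace.IsPhaseSpaceObservable b (PhaseSpace.numberState b s) A) ∧
    ∀ A : PhaseSpace.PositiveOperatorMeasure H,
      PhaseSpace.IsPhaseSpaceObservable b (PhaseSpace.numberState b s) A →
        (∀ m n : ℕ, PhaseSpace.numberSpan b ≤ (A.moment m n).domain) ∧
        A.IsDeterminate ∧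
        ∀ E : PhaseSpace.PositiveOperatorMeasure H,
          (∀ m n : ℕ, (E.moment m n).domRestrict (PhaseSpace.numberSpan b) =
            (A.moment m n).domRestrict (PhaseSpace.numberSpan b)) →
          E = A := by
  refine ⟨⟨PhaseSpace.numberStateObservable b s,
    PhaseSpace.isPhaseSpaceObservable_numberStateObservable b s, fun A hA =>
      hA.unique (PhaseSpace.isPhaseSpaceObservable_numberStateObservable b s)⟩, fun A hA => ?_⟩
  exact ⟨PhaseSpace.numberSpan_le_domain_moment hA,
    fun F hF => PhaseSpace.eq_of_moment_domRestrict_eq hA fun m n => by rw [hF],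
    fun E hE => PhaseSpace.eq_of_moment_domRestrict_eq hA hE⟩
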